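/- Let $M$ be a smooth $n$-dimensional submanifold of $\mathbb R^{n+m}$ (possibly only immersed) and let $Q_0\subset\mathbb R^{n+m}$ be a fixed $m$-dimensional linear subspace. Write $T_pM$, $N_pM$ for the tangent and normal spaces, $(\cdot)^T,(\cdot)^N$ for the orthogonal projections onto them, and $\mathcal P_0,\mathcal P_0^\perp$ for the orthogonal projections onto $Q_0,Q_0^\perp$. For $\theta\in[0,\pi/2]$ let $$N_{p,\theta}M=\{\nu\in N_pM:(\mathcal P_0\nu)^N=\cos^2\theta\,\nu\},\qquad T_{p,\theta}M=\{u\in T_pM:(\mathcal P_0^\perp u)^T=\cos^2\theta\,u\},$$ and let $\mathrm{Arg}^N$ (resp. $\mathrm{Arg}^T$) be the set of $\theta\in[0,\pi/2]$ with $N_{p,\theta}M\neq0$ (resp. $T_{p,\theta}M\ne0$), i.e. the Jordan angles between $N_pM$ and $Q_0$ (resp. $T_pM$ and $Q_0^\perp$). Suppose that $M$ has constant Jordan angles (CJA) relative to $Q_0$: the set of normal Jordan angles, and the multiplicity $\dim N_{p,\theta}M$ of each of them, do not depend on $p\in M$. For $\theta\in(0,\pi/2)$ let $\Phi_\theta$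 be the linear map on $N_{p,\theta}M\oplus T_{p,\theta}M$ with $\sec\theta\,\mathcal P_0\nu=\cos\theta\,\nu-\sin\theta\,\Phi_\theta(\nu)$ and $\sec\theta\,\mathcal P_0^\perp u=\cos\theta\,u-\sin\theta\,\Phi_\theta(u)$ for $\nu\in N_{p,\theta}M$, $u\in T_{p,\theta}M$; put $\Phi_0=\Phi_{\pi/2}=0$. Let $\kappa_{\theta\sigma}=\dfrac{\sin2\theta}{\cos2\theta-\cos2\sigma}$ for $\theta\ne\sigma$. Let $\overline\nabla$ be the flat connection of $\mathbb R^{n+m}$, $B_{XY}=(\overline\nabla_XY)^N$ the second fundamental form, $A^\nu(v)=(-\overline\nabla_v\nu)^T$ the shape operator, and $\nabla B$ the covariant derivative of $B$ with respect to the induced connections on the tangent and normal bundles. Let $(\cdot)^\sigma$ and $(\cdot)_\sigma$ be the orthogonal projections onto $N_{p,\sigma}M$ and $T_{p,\sigma}M$. For $v_1,\dots,v_4\in T_{p,\theta}M$ put $$R_{\theta\sigma}(v_1,v_2,v_3,v_4)=\langle B^\sigma_{v_1v_3},B^\sigma_{v_2v_4}\rangle-\langle B^\sigma_{v_1v_4},B^\sigma_{v_2v_3}\rangle,$$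 $$U_{\theta\sigma}(v_1,v_2,v_3,v_4)=\big\langle(A^{\Phi_\theta(v_3)}v_1)_\sigma,(A^{\Phi_\theta(v_4)}v_2)_\sigma\big\rangle-\big\langle(A^{\Phi_\theta(v_4)}v_1)_\sigma,(A^{\Phi_\theta(v_3)}v_2)_\sigma\big\rangle.$$ Then for every $\theta\in\mathrm{Arg}^T\cap(0,\pi/2)$, every $p\in M$ and all $v,w\in T_{p,\theta}M$, $$\sum_{\sigma\in\mathrm{Arg}^N,\ \sigma\ne\theta}\kappa_{\theta\sigma}R_{\theta\sigma}(v,w,v,w)=3\sum_{\sigma\in\mathrm{Arg}^T,\ \sigma\neq\theta}\kappa_{\theta\sigma}U_{\theta\sigma}(v,w,v,w)$$ and $$\langle(\nabla_vB)_{ww},\Phi_\theta(v)\rangle=\frac13\sum_{\sigma\in\mathrm{Arg}^N,\ \sigma\ne\theta}\kappa_{\theta\sigma}\big(\langle B^\sigma_{vv},B^\sigma_{ww}\rangle+2|B^\sigma_{vw}|^2\big)-2\sum_{\sigma\in\mathrm{Arg}^T,\ \sigma\ne\theta}\kappa_{\sigma\theta}\big\langle B^\sigma_{vw},\Phi_\sigma\big((A^{\Phi_\theta(v)}w)_\sigma\big)\big\rangle.$$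 -/

import Mathlib

open scoped Manifold ContDiff

noncomputable section

namespace CJA

section LinearAlgebra

variable {E : Type*} [NormedAddCommGroup E] [InnerProductSpace ℝ E] [FiniteDimensional ℝ E]

/-- The angle space `P_θ` of `P` relative to `Q`: all `u ∈ P` with `(𝒫 ∘ 𝒬) u = cos² θ • u`, where
`𝒫`, `𝒬` are the orthogonal projections onto `P`, `Q`. -/
def angleSpace (P Q : Submodule ℝ E) (θ : ℝ) : Submodule ℝ E where
  carrier := {u | u ∈ P ∧ P.starProjection (Q.starProjection u) = (Real.cos θ ^ 2) • u}
  add_mem' := by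
    rintro a b ⟨ha, ha'⟩ ⟨hb, hb'⟩
    exact ⟨P.add_mem ha hb, by simp only [map_add, ha', hb', smul_add]⟩
  zero_mem' := ⟨P.zero_mem, by simp⟩
  smul_mem' := by
    rintro c a ⟨ha, ha'⟩
    exact ⟨P.smul_mem c ha, by simp only [map_smul, ha', smul_comm c]⟩

/-- `Arg(P, Q)`: the Jordan (principal) angles between `P` and `Q`, i.e. the `θ ∈ [0, π/2]` for
which `cos² θ` is an eigenvalue of `𝒫 ∘ 𝒬` on `P`. -/
def jordanAngles (P Q : Submodule ℝ E) : Set ℝ :=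
  {θ | 0 ≤ θ ∧ θ ≤ Real.pi / 2 ∧ angleSpace P Q θ ≠ ⊥}

theorem jordanAngles_finite (P Q : Submodule ℝ E) : (jordanAngles P Q).Finite := by
  let T : Module.End ℝ E := (P.starProjection ∘L Q.starProjection : E →L[ℝ] E).toLinearMap
  have hfin : {μ : ℝ | T.HasEigenvalue μ}.Finite := Module.End.finite_hasEigenvalue T
  refine Set.Finite.of_finite_image (f := fun θ => Real.cos θ ^ 2) (hfin.subset ?_) ?_
  · rintro _ ⟨θ, ⟨-, -, hθ⟩, rfl⟩
    obtain ⟨u, hu, hu0⟩ := Submodule.exists_mem_ne_zero_of_ne_bot hθ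
    exact Module.End.hasEigenvalue_of_hasEigenvector
      (Module.End.hasEigenvector_iff.mpr ⟨Module.End.mem_eigenspace_iff.mpr hu.2, hu0⟩)
  · rintro a ⟨ha0, ha1, -⟩ b ⟨hb0, hb1, -⟩ hab
    have hpi := Real.pi_pos
    have ha : 0 ≤ Real.cos a := Real.cos_nonneg_of_mem_Icc ⟨by linarith, ha1⟩
    have hb : 0 ≤ Real.cos b := Real.cos_nonneg_of_mem_Icc ⟨by linarith, hb1⟩
    exact Real.injOn_cos ⟨ha0, by linarith⟩ ⟨hb0, by linarith⟩
      ((sq_eq_sq₀ ha hb).mp hab)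

/-- `Arg(P, Q)` as a finite set, to index sums. -/
def jordanAngleFinset (P Q : Submodule ℝ E) : Finset ℝ := (jordanAngles_finite P Q).toFinset

/-- `κ_{θσ} = sin 2θ / (cos 2θ - cos 2σ)`. -/
def kappa (θ σ : ℝ) : ℝ := Real.sin (2 * θ) / (Real.cos (2 * θ) - Real.cos (2 * σ))

end LinearAlgebra

section Submanifold

variable {n : ℕ} {E : Type*} [NormedAddCommGroup E] [InnerProductSpace ℝ E]
  [FiniteDimensional ℝ E] {M : Type*} [TopologicalSpace M] [ChartedSpace (EuclideanSpace ℝ (Fin n)) M]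

/-- The differential `dF_p`, as a linear map from the tangent space at `p` to `E`. -/
def differential (F : M → E) (p : M) : TangentSpace (𝓡 n) p →L[ℝ] E :=
  mfderiv (𝓡 n) 𝓘(ℝ, E) F p

/-- The tangent plane `T_p M = dF_p(T_p M) ⊆ E` of the immersed submanifold `F : M → E`. -/
def tangentPlane (F : M → E) (p : M) : Submodule ℝ E :=
  LinearMap.range (differential (n := n) F p).toLinearMap

/-- The normal plane `N_p M`. -/
def normalPlane (F : M → E) (p : M) : Submodule ℝ E := (tangentPlane (n := n) F p)ᗮ

/-- `(·)^T`, the orthogonal projection of `E` onto `T_p M`. -/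
def projT (F : M → E) (p : M) : E →L[ℝ] E := (tangentPlane (n := n) F p).starProjection

/-- `(·)^N`, the orthogonal projection of `E` onto `N_p M`. -/
def projN (F : M → E) (p : M) : E →L[ℝ] E := (normalPlane (n := n) F p).starProjection

/-- For `v ∈ T_p M ⊆ E` and `F` an immersion: the unique intrinsic tangent vector `ξ` at `p` with
`dF_p ξ = v`. -/
def tangentLift (F : M → E) (p : M) (v : E) : TangentSpace (𝓡 n) p :=
  (differential (n := n) F p).toLinearMap.leftInverse (projT (n := n) F p v)

/-- The flat connection of `E` along `M`: the derivative at `p` of an `E`-valued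
function `X` on `M` in the direction of `v ∈ T_p M ⊆ E`. -/
def flatDeriv (F : M → E) (p : M) (v : E) (X : M → E) : E :=
  differential (n := n) X p (tangentLift F p v)

/-- The smooth tangent vector field `q ↦ w^T ∈ T_q M`; for `w ∈ T_p M` it extends `w`. -/
def tangentExtension (F : M → E) (w : E) : M → E := fun q => projT (n := n) F q w

/-- The smooth normal vector field `q ↦ ν^N ∈ N_q M`; for `ν ∈ N_p M` it extends `ν`. -/
def normalExtension (F : M → E) (ν : E) : M → E := fun q => projN (n := n) F q ν

/-- The second fundamental form `B_{vw} = (∇̄_v W)^N` for `v, w ∈ T_p M`. The right-hand side does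
not depend on the tangent vector field `W` extending `w`; we use `tangentExtension F w`. -/
def secondFundamentalForm (F : M → E) (p : M) (v w : E) : E :=
  projN (n := n) F p (flatDeriv (n := n) F p v (tangentExtension (n := n) F w))

/-- The shape operator `A^ν(v) = (-∇̄_v ν)^T` for `ν ∈ N_p M`, `v ∈ T_p M`, independent of the
normal field extending `ν`; we use `normalExtension F ν`. -/
def shapeOperator (F : M → E) (p : M) (ν v : E) : E :=
  projT (n := n) F p (-flatDeriv (n := n) F p v (normalExtension (n := n) F ν))

/-- The induced connection `∇_v X = (∇̄_v X)^T` on tangent vector fields. -/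
def tangentConnection (F : M → E) (p : M) (v : E) (X : M → E) : E :=
  projT (n := n) F p (flatDeriv (n := n) F p v X)

/-- The normal connection `∇_v ν = (∇̄_v ν)^N` on normal vector fields. -/
def normalConnection (F : M → E) (p : M) (v : E) (ν : M → E) : E :=
  projN (n := n) F p (flatDeriv (n := n) F p v ν)

/-- The covariant derivative of the second fundamental form,
`(∇_v B)_{xy} = ∇_v (B_{XY}) - B_{∇_v X, y} - B_{x, ∇_v Y}` for `v, x, y ∈ T_p M`, independent of
the tangent vector fields `X, Y` extending `x, y`; we use `tangentExtension`. -/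
def covDerivSecondFundamentalForm (F : M → E) (p : M) (v x y : E) : E :=
  let X := tangentExtension (n := n) F x
  let Y := tangentExtension (n := n) F y
  normalConnection (n := n) F p v (fun q => secondFundamentalForm (n := n) F q (X q) (Y q))
    - secondFundamentalForm (n := n) F p (tangentConnection (n := n) F p v X) y
    - secondFundamentalForm (n := n) F p x (tangentConnection (n := n) F p v Y)

/-- `Arg(N_p M, Q₀)`, the normal Jordan angles at `p`. -/
def argN (F : M → E) (Q₀ : Submodule ℝ E) (p : M) : Finset ℝ :=
  jordanAngleFinset (normalPlane (n := n) F p) Q₀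

/-- `Arg(T_p M, Q₀ᗮ)`, the tangent Jordan angles at `p`. -/
def argT (F : M → E) (Q₀ : Submodule ℝ E) (p : M) : Finset ℝ :=
  jordanAngleFinset (tangentPlane (n := n) F p) Q₀ᗮ

/-- The normal angle space `N_{p,θ} M`. -/
def normalAngleSpace (F : M → E) (Q₀ : Submodule ℝ E) (p : M) (θ : ℝ) : Submodule ℝ E :=
  angleSpace (normalPlane (n := n) F p) Q₀ θ

/-- The tangent angle space `T_{p,θ} M`. -/
def tangentAngleSpace (F : M → E) (Q₀ : Submodule ℝ E) (p : M) (θ : ℝ) : Submodule ℝ E :=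
  angleSpace (tangentPlane (n := n) F p) Q₀ᗮ θ

/-- `F : M → E` has constant Jordan angles relative to `Q₀`: the set of normal Jordan angles is
the same at all points, and so is the multiplicity of each of them. -/
def HasConstantJordanAngles (F : M → E) (Q₀ : Submodule ℝ E) : Prop :=
  (∀ p q : M, argN (n := n) F Q₀ p = argN (n := n) F Q₀ q) ∧
  ∀ p q : M, ∀ θ ∈ argN (n := n) F Q₀ p,
    Module.finrank ℝ (normalAngleSpace (n := n) F Q₀ p θ) =
      Module.finrank ℝ (normalAngleSpace (n := n) F Q₀ q θ)

/-- The anti-involution `Φ_θ` on `R_{p,θ} M = N_{p,θ} M ⊕ T_{p,θ} M`. For `θ ∈ (0, π/2)` it is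
the linear map determined by
`sec θ • 𝒫₀ ν = cos θ • ν - sin θ • Φ_θ ν` for `ν ∈ N_{p,θ} M` and
`sec θ • 𝒫₀ᗮ u = cos θ • u - sin θ • Φ_θ u` for `u ∈ T_{p,θ} M`;
for `θ = 0` or `θ = π/2` it is zero. -/
def antiInvolution (F : M → E) (Q₀ : Submodule ℝ E) (p : M) (θ : ℝ) (x : E) : E :=
  if 0 < θ ∧ θ < Real.pi / 2 then
    (Real.sin θ)⁻¹ • (Real.cos θ • x - (Real.cos θ)⁻¹ •
      (Q₀.starProjection (projN (n := n) F p x) + Q₀ᗮ.starProjection (projT (n := n) F p x)))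
  else 0

/-- `(·)^σ`, the orthogonal projection onto `N_{p,σ} M`. -/
def projNAngle (F : M → E) (Q₀ : Submodule ℝ E) (p : M) (σ : ℝ) : E →L[ℝ] E :=
  (normalAngleSpace (n := n) F Q₀ p σ).starProjection

/-- `(·)_σ`, the orthogonal projection onto `T_{p,σ} M`. -/
def projTAngle (F : M → E) (Q₀ : Submodule ℝ E) (p : M) (σ : ℝ) : E →L[ℝ] E :=
  (tangentAngleSpace (n := n) F Q₀ p σ).starProjection

/-- `B^σ_{vw}`, the component of `B_{vw}` in `N_{p,σ} M`. -/
def secondFundamentalFormAngle (F : M → E) (Q₀ : Submodule ℝ E) (p : M) (σ : ℝ) (v w : E) : E :=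
  projNAngle (n := n) F Q₀ p σ (secondFundamentalForm (n := n) F p v w)

/-- `R_{θσ}(v₁,v₂,v₃,v₄) = ⟨B^σ_{v₁v₃}, B^σ_{v₂v₄}⟩ - ⟨B^σ_{v₁v₄}, B^σ_{v₂v₃}⟩` for
`v₁, …, v₄ ∈ T_{p,θ} M` (the value depends on `θ` only through this domain). -/
def tensorR (F : M → E) (Q₀ : Submodule ℝ E) (p : M) (σ : ℝ) (v₁ v₂ v₃ v₄ : E) : ℝ :=
  inner ℝ (secondFundamentalFormAngle (n := n) F Q₀ p σ v₁ v₃)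
      (secondFundamentalFormAngle (n := n) F Q₀ p σ v₂ v₄)
    - inner ℝ (secondFundamentalFormAngle (n := n) F Q₀ p σ v₁ v₄)
      (secondFundamentalFormAngle (n := n) F Q₀ p σ v₂ v₃)

/-- `(A^{Φ_θ(x)} v)_σ` for `x ∈ T_{p,θ} M`, `v ∈ T_p M`. -/
def shapeAngle (F : M → E) (Q₀ : Submodule ℝ E) (p : M) (θ σ : ℝ) (x v : E) : E :=
  projTAngle (n := n) F Q₀ p σ
    (shapeOperator (n := n) F p (antiInvolution (n := n) F Q₀ p θ x) v)

/-- `U_{θσ}(v₁,v₂,v₃,v₄) = ⟨(A^{Φ_θ(v₃)} v₁)_σ, (A^{Φ_θ(v₄)} v₂)_σ⟩ -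
⟨(A^{Φ_θ(v₄)} v₁)_σ, (A^{Φ_θ(v₃)} v₂)_σ⟩` for `v₁, …, v₄ ∈ T_{p,θ} M`. -/
def tensorU (F : M → E) (Q₀ : Submodule ℝ E) (p : M) (θ σ : ℝ) (v₁ v₂ v₃ v₄ : E) : ℝ :=
  inner ℝ (shapeAngle (n := n) F Q₀ p θ σ v₃ v₁) (shapeAngle (n := n) F Q₀ p θ σ v₄ v₂)
    - inner ℝ (shapeAngle (n := n) F Q₀ p θ σ v₄ v₁) (shapeAngle (n := n) F Q₀ p θ σ v₃ v₂)

end Submanifold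

end CJA

end

open scoped Manifold ContDiff

noncomputable section

/-! Let T be the tangent projection, P the projection onto Q₀, and D = P + T - 1. The operator c = 1
- D² (`angleOp`) commutes with T; it is u ↦ (P⊥u)^T on tangent vectors and ν ↦ (Pν)^N on normal
ones. Hence T_{p,θ}M and N_{p,θ}M are the tangential and normal halves of one eigenspace of c, with
eigenvalue cos² θ. The commutator J = PT - TP (`crossOp`) exchanges the halves and equals sin θ cos
θ Φ_θ there. Constant angles make one fixed polynomial annihilate c at every point, so the theorem
is perturbation theory for an eigenvalue that does not move.

With e the spectral idempotent and R the reduced resolvent at cos² θ, one derivative gives e c′ e =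
0, and a second expresses e c″ e through products e c′ R c′ e (`spectralIdempotent_fderiv`,
`spectralIdempotent_fderiv_fderiv`). Here c′ and c″ are written with β = ∇T and W = ∇²T: β_v sends a
tangent w to B_{vw} and a normal ν to A^ν v, while the normal part of W on tangent vectors is ∇B.

To first order, ⟨B_{aw}, Ju⟩ is skew in w, u ∈ T_θ for every direction a; being symmetric in a, w,
it vanishes for a ∈ T_θ. So B on T_θ has no N_θ component (`idem_beta`), and A^{Φw}a is skew in a, w
∈ T_θ (`beta_crossOp_comm`).

To second order, `second_order` writes ⟨W_{ab}w, Ju⟩ + ⟨W_{ab}u, Jw⟩ as a sum over the other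
eigenvalues. By Codazzi the normal part of W is symmetric in its three tangent arguments, so the
choices (w,w;v,v), (v,v;w,w) and (v,w;w,v) have left sides 2X, 2Y and X + Y. The combination that
cancels them is the first identity; half of the first choice, corrected by a third of that identity,
is the second (`pointwise_identities`). -/

namespace CJA

/-! ### Spectral idempotents by Lagrange interpolation -/

section SpectralIdempotents

variable {𝒜 : Type*} [Ring 𝒜] [Algebra ℝ 𝒜]

/-- The spectral idempotent of `c` at the node `x i`, for `c` annihilated by `∏ (X - x j)`. -/
def spectralIdempotent (S : Finset ℝ) (x : ℝ → ℝ) (c : 𝒜) (i : ℝ) : 𝒜 :=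
  Polynomial.aeval c (Lagrange.basis S x i)

variable {S : Finset ℝ} {x : ℝ → ℝ} {c : 𝒜} {i j : ℝ}

/-- The Lagrange basis polynomial times its missing factor X - x i is a scalar multiple of the nodal
polynomial, which kills `c`. A node need not be an eigenvalue; its idempotent may be zero. -/
theorem mul_spectralIdempotent (hc : Polynomial.aeval c (Lagrange.nodal S x) = 0) (hi : i ∈ S) :
    c * spectralIdempotent S x c i = x i • spectralIdempotent S x c i := by
  have h1 : (Polynomial.X - Polynomial.C (x i)) * Lagrange.basis S x i =
      Polynomial.C (Lagrange.nodalWeight S x i) * Lagrange.nodal S x := by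
    have : Lagrange.basis S x i =
        Polynomial.C (Lagrange.nodalWeight S x i) * Lagrange.nodal (S.erase i) x := by
      simp only [Lagrange.basis, Lagrange.basisDivisor, Lagrange.nodalWeight, Lagrange.nodal,
        Finset.prod_mul_distrib, map_prod]
    rw [this, Lagrange.nodal_eq_mul_nodal_erase hi]
    ring
  have h2 := congrArg (Polynomial.aeval c) h1
  simp only [map_mul, map_sub, Polynomial.aeval_X, Polynomial.aeval_C, hc, mul_zero, sub_mul,
    sub_eq_zero] at h2
  rw [spectralIdempotent, h2, Algebra.smul_def]

theorem spectralIdempotent_mul (hc : Polynomial.aeval c (Lagrange.nodal S x) = 0) (hi : i ∈ S) :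
    spectralIdempotent S x c i * c = x i • spectralIdempotent S x c i := by
  rw [← mul_spectralIdempotent hc hi]
  have := Polynomial.aeval_mul (x := c) (p := Polynomial.X) (q := Lagrange.basis S x i)
  rw [mul_comm, Polynomial.aeval_mul, Polynomial.aeval_X] at this
  exact this

theorem commute_spectralIdempotent {d : 𝒜} (h : Commute c d) :
    Commute (spectralIdempotent S x c i) d := by
  unfold spectralIdempotent
  induction Lagrange.basis S x i using Polynomial.induction_on' with
  | add p q hp hq => rw [map_add]; exact hp.add_left hq
  | monomial n a =>
    rw [Polynomial.aeval_monomial]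
    exact (Algebra.commute_algebraMap_left a d).mul_left (h.pow_left n)

theorem sum_spectralIdempotent (hx : Set.InjOn x S) (hS : S.Nonempty) :
    ∑ i ∈ S, spectralIdempotent S x c i = 1 := by
  unfold spectralIdempotent
  rw [← map_sum, Lagrange.sum_basis hx hS, map_one]

theorem aeval_mul_of_mul_eq_smul {e : 𝒜} {μ : ℝ} (h : c * e = μ • e) (p : Polynomial ℝ) :
    Polynomial.aeval c p * e = p.eval μ • e := by
  induction p using Polynomial.induction_on' with
  | add p q hp hq => rw [map_add, add_mul, hp, hq, Polynomial.eval_add, add_smul]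
  | monomial n a =>
    have : c ^ n * e = μ ^ n • e := by
      induction n with
      | zero => simp
      | succ k ih => rw [pow_succ, mul_assoc, h, mul_smul_comm, ih, smul_smul, pow_succ']
    rw [Polynomial.aeval_monomial, mul_assoc, this, Polynomial.eval_monomial, mul_smul,
      ← Algebra.smul_def]

theorem spectralIdempotent_mul_self (hx : Set.InjOn x S)
    (hc : Polynomial.aeval c (Lagrange.nodal S x) = 0) (hi : i ∈ S) :
    spectralIdempotent S x c i * spectralIdempotent S x c i = spectralIdempotent S x c i := by
  conv_lhs => arg 1; rw [spectralIdempotent]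
  rw [aeval_mul_of_mul_eq_smul (mul_spectralIdempotent hc hi), Lagrange.eval_basis_self hx hi,
    one_smul]

/-- The reduced resolvent of `c` at the eigenvalue `x i`. -/
def reducedResolvent (S : Finset ℝ) (x : ℝ → ℝ) (c : 𝒜) (i : ℝ) : 𝒜 :=
  ∑ j ∈ S.erase i, (x i - x j)⁻¹ • spectralIdempotent S x c j

theorem sub_eq_sum_erase (hx : Set.InjOn x S) (hi : i ∈ S) :
    1 - spectralIdempotent S x c i = ∑ j ∈ S.erase i, spectralIdempotent S x c j := by
  rw [← sum_spectralIdempotent (c := c) hx ⟨i, hi⟩, ← Finset.add_sum_erase S _ hi,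
    add_sub_cancel_left]

/-- On the image of the j-th idempotent c - x i acts as x j - x i, which (x i - x j)⁻¹ inverts up to
sign. What remains is minus the sum of the idempotents with j ≠ i. -/
theorem reducedResolvent_mul (hx : Set.InjOn x S)
    (hc : Polynomial.aeval c (Lagrange.nodal S x) = 0) (hi : i ∈ S) :
    reducedResolvent S x c i * (c - x i • 1) = spectralIdempotent S x c i - 1 := by
  rw [← neg_sub (1 : 𝒜), sub_eq_sum_erase hx hi, reducedResolvent, Finset.sum_mul,
    ← Finset.sum_neg_distrib]
  refine Finset.sum_congr rfl fun j hj => ?_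
  have hj' := Finset.mem_erase.mp hj
  have hne : x i - x j ≠ 0 := sub_ne_zero.mpr fun h => hj'.1 (hx hi hj'.2 h).symm
  rw [smul_mul_assoc, mul_sub, spectralIdempotent_mul hc hj'.2, mul_smul_comm, mul_one, ← sub_smul,
    smul_smul, ← neg_sub (x i), mul_neg, inv_mul_cancel₀ hne, neg_one_smul]

theorem mul_reducedResolvent (hx : Set.InjOn x S)
    (hc : Polynomial.aeval c (Lagrange.nodal S x) = 0) (hi : i ∈ S) :
    (c - x i • 1) * reducedResolvent S x c i = spectralIdempotent S x c i - 1 := by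
  rw [← reducedResolvent_mul hx hc hi, reducedResolvent, Finset.sum_mul, Finset.mul_sum]
  refine Finset.sum_congr rfl fun j hj => ?_
  have hj' := Finset.mem_erase.mp hj
  rw [smul_mul_assoc, mul_smul_comm, mul_sub, sub_mul, spectralIdempotent_mul hc hj'.2,
    mul_spectralIdempotent hc hj'.2, mul_smul_comm, smul_mul_assoc, mul_one, one_mul]

end SpectralIdempotents

/-! ### Derivatives of an operator with a constant eigenvalue -/

section Perturbation

variable {V : Type*} [NormedAddCommGroup V] [NormedSpace ℝ V]
  {𝒜 : Type*} [NormedRing 𝒜] [NormedAlgebra ℝ 𝒜]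
  {S : Finset ℝ} {x : ℝ → ℝ} {i : ℝ} {c : V → 𝒜} {p₀ : V}

/-- The nodes do not depend on the point, so the idempotent is a polynomial in `c p` with fixed
coefficients and inherits its differentiability. -/
theorem differentiableAt_spectralIdempotent (hd : DifferentiableAt ℝ c p₀) :
    DifferentiableAt ℝ (fun p => spectralIdempotent S x (c p) i) p₀ := by
  unfold spectralIdempotent
  induction Lagrange.basis S x i using Polynomial.induction_on' with
  | add p q hp hq => simp only [map_add]; exact hp.fun_add hq
  | monomial n a =>
    simp only [Polynomial.aeval_monomial, ← Algebra.smul_def]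
    refine DifferentiableAt.fun_const_smul ?_ a
    induction n with
    | zero => simp
    | succ k ih => simp only [pow_succ]; exact ih.fun_mul hd

/-- The first-order condition for an eigenvalue to be constant. -/
theorem spectralIdempotent_fderiv
    (hc : ∀ᶠ p in nhds p₀, Polynomial.aeval (c p) (Lagrange.nodal S x) = 0)
    (hi : i ∈ S) (hd : DifferentiableAt ℝ c p₀) (a : V) :
    spectralIdempotent S x (c p₀) i * fderiv ℝ c p₀ a * spectralIdempotent S x (c p₀) i = 0 ∧
    fderiv ℝ c p₀ a * spectralIdempotent S x (c p₀) i + (c p₀ - x i • 1) *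
      fderiv ℝ (fun p => spectralIdempotent S x (c p) i) p₀ a = 0 ∧
    spectralIdempotent S x (c p₀) i * fderiv ℝ c p₀ a +
      fderiv ℝ (fun p => spectralIdempotent S x (c p) i) p₀ a * (c p₀ - x i • 1) = 0 := by
  have hE := differentiableAt_spectralIdempotent (S := S) (x := x) (i := i) hd
  have hcx : DifferentiableAt ℝ (fun p => c p - x i • (1 : 𝒜)) p₀ := hd.sub_const _
  have e1 : fderiv ℝ (fun p => (c p - x i • (1 : 𝒜)) * spectralIdempotent S x (c p) i) p₀ = 0 := by
    have : (fun p => (c p - x i • (1 : 𝒜)) * spectralIdempotent S x (c p) i) =ᶠ[nhds p₀]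
        fun _ => 0 := by
      filter_upwards [hc] with p hp
      rw [sub_mul, mul_spectralIdempotent hp hi, smul_mul_assoc, one_mul, sub_self]
    rw [this.fderiv_eq]; simp
  have e2 : fderiv ℝ (fun p => spectralIdempotent S x (c p) i * (c p - x i • (1 : 𝒜))) p₀ = 0 := by
    have : (fun p => spectralIdempotent S x (c p) i * (c p - x i • (1 : 𝒜))) =ᶠ[nhds p₀]
        fun _ => 0 := by
      filter_upwards [hc] with p hp
      rw [mul_sub, spectralIdempotent_mul hp hi, mul_smul_comm, mul_one, sub_self]
    rw [this.fderiv_eq]; simp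
  have f1 := congrArg (· a) e1
  have f2 := congrArg (· a) e2
  rw [fderiv_fun_mul' hcx hE] at f1
  rw [fderiv_fun_mul' hE hcx] at f2
  simp only [fderiv_sub_const, add_apply, smul_apply,
    zero_apply, smul_eq_mul, MulOpposite.smul_eq_mul_unop,
    MulOpposite.unop_op] at f1 f2
  refine ⟨?_, by rw [add_comm]; exact f1, f2⟩
  -- Multiplying the differentiated eigenvalue equation by e on the left removes the derivative of
  -- e, since e (c - x i) = 0.
  have := congrArg (spectralIdempotent S x (c p₀) i * ·) f1
  simp only [mul_add, mul_zero, ← mul_assoc] at this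
  rw [mul_sub, spectralIdempotent_mul hc.self_of_nhds hi, mul_smul_comm, mul_one, sub_self,
    zero_mul, zero_add] at this
  exact this

/-- The second-order condition for an eigenvalue to be constant. -/
theorem spectralIdempotent_fderiv_fderiv
    (hc : ∀ᶠ p in nhds p₀, Polynomial.aeval (c p) (Lagrange.nodal S x) = 0)
    (hx : Set.InjOn x S) (hi : i ∈ S) (hd : ∀ᶠ p in nhds p₀, DifferentiableAt ℝ c p)
    (Y : V → V) (hY : DifferentiableAt ℝ (fun p => fderiv ℝ c p (Y p)) p₀) (a : V) :
    let e := spectralIdempotent S x (c p₀) i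
    e * fderiv ℝ (fun p => fderiv ℝ c p (Y p)) p₀ a * e =
      -(e * fderiv ℝ c p₀ a * reducedResolvent S x (c p₀) i * fderiv ℝ c p₀ (Y p₀) * e +
        e * fderiv ℝ c p₀ (Y p₀) * reducedResolvent S x (c p₀) i * fderiv ℝ c p₀ a * e) := by
  intro e
  have hd0 := hd.self_of_nhds
  have hc0 := hc.self_of_nhds
  have hE := differentiableAt_spectralIdempotent (S := S) (x := x) (i := i) hd0
  -- The first-order condition holds at every nearby point, so it may be differentiated again.
  have e1 : fderiv ℝ (fun p => spectralIdempotent S x (c p) i * fderiv ℝ c p (Y p) *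
      spectralIdempotent S x (c p) i) p₀ = 0 := by
    have : (fun p => spectralIdempotent S x (c p) i * fderiv ℝ c p (Y p) *
      spectralIdempotent S x (c p) i) =ᶠ[nhds p₀] fun _ => 0 := by
      filter_upwards [hc.eventually_nhds, hd] with p hp hdp
      exact (spectralIdempotent_fderiv hp hi hdp (Y p)).1
    rw [this.fderiv_eq]; simp
  have f1 := congrArg (· a) e1
  rw [fderiv_fun_mul' (hE.fun_mul hY) hE, fderiv_fun_mul' hE hY] at f1
  simp only [add_apply, smul_apply,
    zero_apply, smul_eq_mul, MulOpposite.smul_eq_mul_unop,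
    MulOpposite.unop_op] at f1
  obtain ⟨g1, g2, g3⟩ := spectralIdempotent_fderiv hc hi hd0 a
  obtain ⟨k1, k2, k3⟩ := spectralIdempotent_fderiv hc hi hd0 (Y p₀)
  have r1 := reducedResolvent_mul hx hc0 hi
  have r2 := mul_reducedResolvent hx hc0 hi
  have ee : e * e = e := spectralIdempotent_mul_self hx hc0 hi
  change _ = e - 1 at r1
  change _ = e - 1 at r2
  change e * _ * e = 0 at g1
  change e * _ * e = 0 at k1
  change _ * e + _ = 0 at g2
  change e * _ + _ = 0 at g3
  change e * _ * _ + (e * _ + _ * _) * e = 0 at f1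
  generalize fderiv ℝ (fun p => spectralIdempotent S x (c p) i) p₀ a = E' at *
  generalize fderiv ℝ (fun p => fderiv ℝ c p (Y p)) p₀ a = C2 at *
  generalize fderiv ℝ c p₀ a = Ca at *
  generalize fderiv ℝ c p₀ (Y p₀) = Cb at *
  generalize reducedResolvent S x (c p₀) i = R at *
  generalize c p₀ - x i • (1 : 𝒜) = L at *
  generalize e = e at *
  -- Applying R to (c - x i) E' = -Ca e recovers the part of E' outside the image of e. In the
  -- products below, the remaining part e E' or E' e meets e Cb e = 0.
  have h1 : E' = e * E' + R * Ca * e := by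
    have := congrArg (R * ·) g2
    simp only [mul_add, ← mul_assoc, r1, mul_zero, sub_mul, one_mul] at this
    refine sub_eq_zero.mp (neg_eq_zero.mp (Eq.trans ?_ this))
    abel
  have h2 : E' = E' * e + e * Ca * R := by
    have := congrArg (· * R) g3
    simp only [add_mul, mul_assoc, r2, zero_mul, mul_sub, mul_one] at this
    simp only [mul_assoc]
    refine sub_eq_zero.mp (neg_eq_zero.mp (Eq.trans ?_ this))
    abel
  have h3 := congrArg (fun z => e * z * e) f1
  have s1 : e * (e * Cb * E') * e = e * Cb * R * Ca * e := by
    calc e * (e * Cb * E') * e = (e * e) * Cb * (e * E' + R * Ca * e) * e := by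
          rw [← h1]; noncomm_ring
      _ = (e * Cb * e) * E' * e + e * Cb * R * Ca * e := by rw [ee]; noncomm_ring; rw [ee]
      _ = _ := by rw [k1]; noncomm_ring
  have s2 : e * (E' * Cb * e) * e = e * Ca * R * Cb * e := by
    calc e * (E' * Cb * e) * e = e * (E' * e + e * Ca * R) * Cb * (e * e) := by
          rw [← h2]; noncomm_ring
      _ = e * E' * (e * Cb * e) + e * Ca * R * Cb * e := by
          conv_rhs => rw [← ee]
          noncomm_ring
          simp only [← mul_assoc, ee]
          abel
      _ = _ := by rw [k1]; noncomm_ring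
  have s3 : e * (e * C2 * e) * e = e * C2 * e := by
    calc e * (e * C2 * e) * e = (e * e) * C2 * (e * e) := by noncomm_ring
      _ = _ := by rw [ee]
  simp only [mul_add, add_mul, mul_zero, zero_mul] at h3
  rw [s1] at h3
  have h4 : e * (e * C2) * e * e = e * (e * C2 * e) * e := by noncomm_ring
  have h5 : e * (E' * Cb) * e * e = e * (E' * Cb * e) * e := by noncomm_ring
  simp only [← mul_assoc] at h3 s1 s2 s3
  rw [s3, s2] at h3
  refine sub_eq_zero.mp (Eq.trans ?_ h3)
  abel

end Perturbation

/-! ### Smooth pseudo-inverse of an injective linear map -/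

section PseudoInverse

variable {V E : Type*} [NormedAddCommGroup V] [InnerProductSpace ℝ V] [FiniteDimensional ℝ V]
  [NormedAddCommGroup E] [InnerProductSpace ℝ E] [FiniteDimensional ℝ E]

/-- The Moore-Penrose inverse of an injective linear map. -/
def pinv (L : V →L[ℝ] E) : E →L[ℝ] V :=
  ContinuousLinearMap.inverse (L.adjoint ∘L L) ∘L L.adjoint

theorem exists_equiv_adjoint_comp {L : V →L[ℝ] E} (hL : Function.Injective L) :
    ∃ e : V ≃L[ℝ] V, (e : V →L[ℝ] V) = L.adjoint ∘L L := by
  have hinj : Function.Injective (L.adjoint ∘L L).toLinearMap := by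
    rw [← LinearMap.ker_eq_bot, LinearMap.ker_eq_bot']
    intro v hv
    have h : inner ℝ (L v) (L v) = 0 := by
      rw [← ContinuousLinearMap.adjoint_inner_left]
      have : L.adjoint (L v) = 0 := hv
      rw [this, inner_zero_left]
    exact hL ((inner_self_eq_zero.mp h).trans (map_zero L).symm)
  refine ⟨(LinearEquiv.ofInjectiveEndo _ hinj).toContinuousLinearEquiv, ?_⟩
  ext v
  rfl

theorem inverse_adjoint_comp {L : V →L[ℝ] E} (hL : Function.Injective L) :
    ContinuousLinearMap.inverse (L.adjoint ∘L L) ∘L (L.adjoint ∘L L) = 1 ∧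
    (L.adjoint ∘L L) ∘L ContinuousLinearMap.inverse (L.adjoint ∘L L) = 1 := by
  obtain ⟨e, he⟩ := exists_equiv_adjoint_comp hL
  rw [← he, ContinuousLinearMap.inverse_equiv]
  constructor <;> ext v <;> simp

theorem pinv_apply_apply {L : V →L[ℝ] E} (hL : Function.Injective L) (v : V) :
    pinv L (L v) = v := by
  have := (inverse_adjoint_comp hL).1
  exact congrArg (· v) this

/-- These are the normal equations: L* (w - L (pinv L w)) = 0 says that the error is orthogonal to
the range. -/
theorem apply_pinv {L : V →L[ℝ] E} (hL : Function.Injective L) (w : E) :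
    L (pinv L w) = (LinearMap.range L.toLinearMap).starProjection w := by
  symm
  apply Submodule.eq_starProjection_of_mem_of_inner_eq_zero
    (LinearMap.mem_range.mpr ⟨pinv L w, rfl⟩)
  rintro _ ⟨v, rfl⟩
  have h : L.adjoint (L (pinv L w)) = L.adjoint w :=
    congrArg (· (L.adjoint w)) (inverse_adjoint_comp hL).2
  change inner ℝ (w - L (pinv L w)) (L v) = 0
  rw [← ContinuousLinearMap.adjoint_inner_left, map_sub, h, sub_self, inner_zero_left]

variable (V E) in
/-- The adjoint, as a continuous real-linear map. -/
def adjointL : (V →L[ℝ] E) →L[ℝ] (E →L[ℝ] V) :=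
  LinearMap.toContinuousLinearMap
    { toFun := fun L => L.adjoint
      map_add' := fun a b => map_add _ a b
      map_smul' := fun r a => by simp }

theorem contDiffAt_pinv {L : V →L[ℝ] E} (hL : Function.Injective L) :
    ContDiffAt ℝ ∞ (pinv : (V →L[ℝ] E) → (E →L[ℝ] V)) L := by
  obtain ⟨e, he⟩ := exists_equiv_adjoint_comp hL
  have h1 : ContDiffAt ℝ ∞ (fun L : V →L[ℝ] E => L.adjoint) L := (adjointL V E).contDiff.contDiffAt
  have h2 : ContDiffAt ℝ ∞ (fun L : V →L[ℝ] E => L.adjoint ∘L L) L := h1.clm_comp contDiffAt_id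
  have h3 := contDiffAt_map_inverse (𝕜 := ℝ) (n := ∞) e
  rw [he] at h3
  exact (h3.comp (f := fun L : V →L[ℝ] E => L.adjoint ∘L L) L h2).clm_comp h1

end PseudoInverse

/-! ### Second derivatives of smooth maps -/

section Smooth

variable {V E : Type*} [NormedAddCommGroup V] [NormedSpace ℝ V] [NormedAddCommGroup E]
  [NormedSpace ℝ E] {G : V → E} {U : Set V} {x : V}

theorem two_le_infty : (2 : WithTop ℕ∞) ≤ ∞ :=
  WithTop.coe_le_coe.mpr le_top

theorem contDiffAt_fderiv_of_isOpen (hU : IsOpen U) (hG : ContDiffOn ℝ ∞ G U) (hx : x ∈ U) :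
    ContDiffAt ℝ ∞ (fderiv ℝ G) x :=
  (hG.contDiffAt (hU.mem_nhds hx)).fderiv_right (by simp)

theorem second_fderiv_comm (hU : IsOpen U) (hG : ContDiffOn ℝ ∞ G U) (hx : x ∈ U) (ξ η : V) :
    fderiv ℝ (fderiv ℝ G) x ξ η = fderiv ℝ (fderiv ℝ G) x η ξ :=
  (hG.contDiffAt (hU.mem_nhds hx)).isSymmSndFDerivAt (by simpa using two_le_infty) ξ η

end Smooth

/-! ### First and second derivatives of the tangent projection of a local immersion -/

section LocalImmersion

variable {V E : Type*} [NormedAddCommGroup V] [InnerProductSpace ℝ V] [FiniteDimensional ℝ V]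
  [NormedAddCommGroup E] [InnerProductSpace ℝ E] [FiniteDimensional ℝ E]
  {Z : Type*} [NormedAddCommGroup Z] [NormedSpace ℝ Z]

/-- The orthogonal projection onto the tangent planes of the local immersion `G`. -/
def localProj (G : V → E) (x : V) : E →L[ℝ] E := fderiv ℝ G x ∘L pinv (fderiv ℝ G x)

/-- The derivative of `X` along the tangential part of the constant field `v`. -/
def tderiv (G : V → E) (X : V → Z) (v : E) (x : V) : Z := fderiv ℝ X x (pinv (fderiv ℝ G x) v)

/-- The derivative of the tangent projection of the local immersion `G`. -/
def localB (G : V → E) (v : E) (x : V) : E →L[ℝ] E := tderiv G (localProj G) v x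

/-- The second covariant derivative of the tangent projection of the local immersion `G`. -/
def localW (G : V → E) (v w : E) (x : V) : E →L[ℝ] E := tderiv G (localB G w) v x

variable {G : V → E} {U : Set V} {x : V}

theorem localProj_eq (hinj : Function.Injective (fderiv ℝ G x)) :
    localProj G x = (LinearMap.range (fderiv ℝ G x).toLinearMap).starProjection := by
  ext w
  exact apply_pinv hinj w

theorem localProj_mul_self (hinj : Function.Injective (fderiv ℝ G x)) :
    localProj G x * localProj G x = localProj G x := by
  rw [localProj_eq hinj]
  exact Submodule.isIdempotentElem_starProjection _

theorem isSelfAdjoint_localProj (hinj : Function.Injective (fderiv ℝ G x)) :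
    IsSelfAdjoint (localProj G x) := by
  rw [localProj_eq hinj]
  exact isSelfAdjoint_starProjection _

theorem localProj_fderiv (hinj : Function.Injective (fderiv ℝ G x)) (ξ : V) :
    localProj G x (fderiv ℝ G x ξ) = fderiv ℝ G x ξ := by
  change fderiv ℝ G x (pinv _ _) = _
  rw [pinv_apply_apply hinj]

theorem pinv_localProj (hinj : Function.Injective (fderiv ℝ G x)) (v : E) :
    pinv (fderiv ℝ G x) (localProj G x v) = pinv (fderiv ℝ G x) v := by
  change pinv _ (fderiv ℝ G x (pinv _ _)) = _
  rw [pinv_apply_apply hinj]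

theorem localB_localProj (hinj : Function.Injective (fderiv ℝ G x)) (v : E) :
    localB G (localProj G x v) x = localB G v x := by
  simp only [localB, tderiv, pinv_localProj hinj]

section

variable (hU : IsOpen U) (hG : ContDiffOn ℝ ∞ G U)
  (hinj : ∀ x ∈ U, Function.Injective (fderiv ℝ G x)) (hx : x ∈ U)

include hU hG hinj hx

theorem contDiffAt_pinv_fderiv : ContDiffAt ℝ ∞ (fun x => pinv (fderiv ℝ G x)) x :=
  (contDiffAt_pinv (hinj x hx)).comp x (contDiffAt_fderiv_of_isOpen hU hG hx)

theorem contDiffAt_localProj : ContDiffAt ℝ ∞ (localProj G) x :=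
  (contDiffAt_fderiv_of_isOpen hU hG hx).clm_comp (contDiffAt_pinv_fderiv hU hG hinj hx)

theorem contDiffAt_localB (v : E) : ContDiffAt ℝ ∞ (localB G v) x :=
  ((contDiffAt_localProj hU hG hinj hx).fderiv_right (m := ∞) (by simp)).clm_apply
    ((contDiffAt_pinv_fderiv hU hG hinj hx).clm_apply contDiffAt_const)

theorem differentiableAt_localProj : DifferentiableAt ℝ (localProj G) x :=
  (contDiffAt_localProj hU hG hinj hx).differentiableAt (by simp)

theorem differentiableAt_localB (v : E) : DifferentiableAt ℝ (localB G v) x :=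
  (contDiffAt_localB hU hG hinj hx v).differentiableAt (by simp)

/-- The derivative of T² = T. It says that β exchanges tangent and normal vectors. -/
theorem localB_eq (v : E) :
    localB G v x = localB G v x * localProj G x + localProj G x * localB G v x := by
  have hd := differentiableAt_localProj hU hG hinj hx
  have h : (fun x => localProj G x * localProj G x) =ᶠ[nhds x] localProj G := by
    filter_upwards [hU.mem_nhds hx] with y hy using localProj_mul_self (hinj y hy)
  have h1 := congrArg (· (pinv (fderiv ℝ G x) v)) (h.fderiv_eq (𝕜 := ℝ))
  rw [fderiv_fun_mul' hd hd] at h1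
  exact h1.symm.trans (add_comm _ _)

theorem localProj_localB (v : E) {u : E} (hu : localProj G x u = u) :
    localProj G x (localB G v x u) = 0 := by
  have := congrArg (· u) (localB_eq hU hG hinj hx v)
  simpa [hu] using this

theorem isSelfAdjoint_localB (v : E) : IsSelfAdjoint (localB G v x) := by
  have hd := differentiableAt_localProj hU hG hinj hx
  have h : (fun x => adjointL E E (localProj G x)) =ᶠ[nhds x] localProj G := by
    filter_upwards [hU.mem_nhds hx] with y hy using isSelfAdjoint_localProj (hinj y hy)
  have h1 := congrArg (· (pinv (fderiv ℝ G x) v)) (h.fderiv_eq (𝕜 := ℝ))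
  rw [fderiv_fun_comp x (adjointL E E).differentiableAt hd] at h1
  rw [ContinuousLinearMap.fderiv] at h1
  exact h1

theorem isSelfAdjoint_localW (v w : E) : IsSelfAdjoint (localW G v w x) := by
  have hd := differentiableAt_localB hU hG hinj hx w
  have h : (fun x => adjointL E E (localB G w x)) =ᶠ[nhds x] localB G w := by
    filter_upwards [hU.mem_nhds hx] with y hy using isSelfAdjoint_localB hU hG hinj hy w
  have h1 := congrArg (· (pinv (fderiv ℝ G x) v)) (h.fderiv_eq (𝕜 := ℝ))
  rw [fderiv_fun_comp x (adjointL E E).differentiableAt hd] at h1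
  rw [ContinuousLinearMap.fderiv] at h1
  exact h1

/-- The derivative of β = βT + Tβ. It determines the diagonal blocks of W by products of two β's. -/
theorem localW_eq (v w : E) :
    localW G v w x = localW G v w x * localProj G x + localProj G x * localW G v w x +
      (localB G v x * localB G w x + localB G w x * localB G v x) := by
  have hT := differentiableAt_localProj hU hG hinj hx
  have hB := differentiableAt_localB hU hG hinj hx w
  have h : localB G w =ᶠ[nhds x]
      (fun x => localB G w x * localProj G x + localProj G x * localB G w x) := by
    filter_upwards [hU.mem_nhds hx] with y hy using localB_eq hU hG hinj hy w
  have h1 := congrArg (· (pinv (fderiv ℝ G x) v)) (h.fderiv_eq (𝕜 := ℝ))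
  rw [fderiv_fun_add (hB.fun_mul hT) (hT.fun_mul hB), fderiv_fun_mul' hB hT,
    fderiv_fun_mul' hT hB] at h1
  change localW G v w x = (localB G w x * localB G v x + localW G v w x * localProj G x) +
    (localProj G x * localW G v w x + localB G v x * localB G w x) at h1
  refine h1.trans ?_
  abel

/-- Differentiating T(dG ξ) = dG ξ exhibits β on tangent vectors as the normal part of the Hessian
of G, which makes the second fundamental form symmetric. -/
theorem localB_fderiv (v : E) (ξ : V) :
    localB G v x (fderiv ℝ G x ξ) =
      fderiv ℝ (fderiv ℝ G) x (pinv (fderiv ℝ G x) v) ξ -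
        localProj G x (fderiv ℝ (fderiv ℝ G) x (pinv (fderiv ℝ G x) v) ξ) := by
  have hT := differentiableAt_localProj hU hG hinj hx
  have hd := (contDiffAt_fderiv_of_isOpen hU hG hx).differentiableAt (by simp)
  have hdξ : DifferentiableAt ℝ (fun y => fderiv ℝ G y ξ) x :=
    hd.clm_apply (differentiableAt_const ξ)
  have h : (fun y => localProj G y (fderiv ℝ G y ξ)) =ᶠ[nhds x] fun y => fderiv ℝ G y ξ := by
    filter_upwards [hU.mem_nhds hx] with y hy using localProj_fderiv (hinj y hy) ξ
  have h1 := congrArg (· (pinv (fderiv ℝ G x) v)) (h.fderiv_eq (𝕜 := ℝ))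
  rw [fderiv_clm_apply hT hdξ, fderiv_clm_apply hd (differentiableAt_const ξ)] at h1
  simp at h1
  exact eq_sub_iff_add_eq'.mpr h1

/-- Symmetry of the second fundamental form. -/
theorem localB_comm (v w : E) :
    localB G v x (localProj G x w) = localB G w x (localProj G x v) := by
  change localB G v x (fderiv ℝ G x _) = localB G w x (fderiv ℝ G x _)
  rw [localB_fderiv hU hG hinj hx, localB_fderiv hU hG hinj hx,
    second_fderiv_comm hU hG hx]
  rfl

/-- The tangential parts of the constant fields v and w have zero Lie bracket at a point where v and
w are tangent. After applying dG, the derivative is β_v w minus a Hessian term, and both are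
symmetric. -/
theorem fderiv_pinv_comm (v w : E) (hv : localProj G x v = v) (hw : localProj G x w = w) :
    fderiv ℝ (fun y => pinv (fderiv ℝ G y) w) x (pinv (fderiv ℝ G x) v) =
      fderiv ℝ (fun y => pinv (fderiv ℝ G y) v) x (pinv (fderiv ℝ G x) w) := by
  have hT := differentiableAt_localProj hU hG hinj hx
  have hd := (contDiffAt_fderiv_of_isOpen hU hG hx).differentiableAt (by simp)
  have hA := (contDiffAt_pinv_fderiv hU hG hinj hx).differentiableAt (by simp)
  have key : ∀ v w : E, fderiv ℝ G x (fderiv ℝ (fun y => pinv (fderiv ℝ G y) w) x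
      (pinv (fderiv ℝ G x) v)) = localB G v x w - fderiv ℝ (fderiv ℝ G) x
        (pinv (fderiv ℝ G x) v) (pinv (fderiv ℝ G x) w) := by
    intro v w
    have hAw : DifferentiableAt ℝ (fun y => pinv (fderiv ℝ G y) w) x :=
      hA.clm_apply (differentiableAt_const w)
    have h : (fun y => localProj G y w) = fun y => fderiv ℝ G y (pinv (fderiv ℝ G y) w) := rfl
    have h1 := congrArg (fun f => fderiv ℝ f x (pinv (fderiv ℝ G x) v)) h
    simp only [fderiv_clm_apply hd hAw, fderiv_clm_apply hT (differentiableAt_const w)] at h1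
    simp at h1
    rw [eq_sub_iff_add_eq, ← h1]
    rfl
  apply hinj x hx
  rw [key, key, second_fderiv_comm hU hG hx]
  have := localB_comm hU hG hinj hx v w
  rw [hv, hw] at this
  rw [this]

/-- Since the bracket of the two fields vanishes at the point, commuting the two derivatives of T is
Schwarz's theorem. -/
theorem localW_comm (v w : E) (hv : localProj G x v = v) (hw : localProj G x w = w) :
    localW G v w x = localW G w v x := by
  have hT' := ((contDiffAt_localProj hU hG hinj hx).fderiv_right (m := ∞) (by simp)).differentiableAt
    (by simp)
  have hA := (contDiffAt_pinv_fderiv hU hG hinj hx).differentiableAt (by simp)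
  have key : ∀ v w : E, localW G v w x = fderiv ℝ (localProj G) x
      (fderiv ℝ (fun y => pinv (fderiv ℝ G y) w) x (pinv (fderiv ℝ G x) v)) +
      fderiv ℝ (fderiv ℝ (localProj G)) x (pinv (fderiv ℝ G x) v) (pinv (fderiv ℝ G x) w) := by
    intro v w
    have hAw : DifferentiableAt ℝ (fun y => pinv (fderiv ℝ G y) w) x :=
      hA.clm_apply (differentiableAt_const w)
    change fderiv ℝ (fun y => fderiv ℝ (localProj G) y (pinv (fderiv ℝ G y) w)) x _ = _
    rw [fderiv_clm_apply hT' hAw]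
    rfl
  rw [key, key, fderiv_pinv_comm hU hG hinj hx v w hv hw]
  congr 1
  exact (contDiffAt_localProj hU hG hinj hx).isSymmSndFDerivAt
    (by simpa using two_le_infty) _ _

/-- The Codazzi equation. -/
theorem localW_apply_comm (v w u : E) (hw : localProj G x w = w)
    (hu : localProj G x u = u) :
    localW G v w x u + localB G w x (localB G v x u) =
      localW G v u x w + localB G u x (localB G v x w) := by
  have hT := differentiableAt_localProj hU hG hinj hx
  have key : ∀ w u : E, fderiv ℝ (fun y => localB G w y (localProj G y u)) x
      (pinv (fderiv ℝ G x) v) =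
      localW G v w x (localProj G x u) + localB G w x (localB G v x u) := by
    intro w u
    have hTu : DifferentiableAt ℝ (fun y => localProj G y u) x :=
      hT.clm_apply (differentiableAt_const u)
    rw [fderiv_clm_apply (differentiableAt_localB hU hG hinj hx w) hTu,
      fderiv_clm_apply hT (differentiableAt_const u)]
    simp
    rw [add_comm]
    rfl
  -- Codazzi is the derivative of the symmetry of B, which holds near x; differentiating T u and T w
  -- produces the ββ terms.
  have h : (fun y => localB G w y (localProj G y u)) =ᶠ[nhds x]
      fun y => localB G u y (localProj G y w) := by
    filter_upwards [hU.mem_nhds hx] with y hy using localB_comm hU hG hinj hy w u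
  have h1 := congrArg (· (pinv (fderiv ℝ G x) v)) (h.fderiv_eq (𝕜 := ℝ))
  simp only [key, hw, hu] at h1
  exact h1

end

end LocalImmersion

/-! ### Algebra of two projections -/

section ProjectionPair

variable {𝒜 : Type*} [Ring 𝒜] {T P : 𝒜}

/-- `cos²` of the angle between the projections `1 - T` and `P`. -/
def angleOp (T P : 𝒜) : 𝒜 := 1 - (P + T - 1) * (P + T - 1)

/-- The commutator of two projections. -/
def crossOp (T P : 𝒜) : 𝒜 := P * T - T * P

/-- With D = P + T - 1 one has D T = P D and D P = T D, so D² commutes with both projections. -/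
theorem commute_angleOp_left (hT : T * T = T) (hP : P * P = P) : Commute (angleOp T P) T := by
  have hT' : ∀ z, T * (T * z) = T * z := fun z => by rw [← mul_assoc, hT]
  simp only [Commute, SemiconjBy, angleOp, mul_add, add_mul, mul_sub, sub_mul, mul_one, one_mul,
    mul_assoc, hT, hP, hT']
  abel

theorem commute_angleOp_crossOp (hT : T * T = T) (hP : P * P = P) :
    Commute (angleOp T P) (crossOp T P) := by
  have hT' : ∀ z, T * (T * z) = T * z := fun z => by rw [← mul_assoc, hT]
  have hP' : ∀ z, P * (P * z) = P * z := fun z => by rw [← mul_assoc, hP]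
  simp only [Commute, SemiconjBy, angleOp, crossOp, mul_add, add_mul, mul_sub, sub_mul, mul_one,
    one_mul, mul_assoc, hT, hP, hT', hP']
  abel

/-- On the eigenspace of cos² θ this reads J² = -cos² θ sin² θ, the relation Φ² = -1 after
rescaling. -/
theorem crossOp_mul_crossOp (hT : T * T = T) (hP : P * P = P) :
    crossOp T P * crossOp T P = angleOp T P * angleOp T P - angleOp T P := by
  have hT' : ∀ z, T * (T * z) = T * z := fun z => by rw [← mul_assoc, hT]
  have hP' : ∀ z, P * (P * z) = P * z := fun z => by rw [← mul_assoc, hP]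
  simp only [angleOp, crossOp, mul_add, add_mul, mul_sub, sub_mul, mul_one, one_mul, mul_assoc, hT,
    hP, hT', hP']
  abel

theorem mul_crossOp (hT : T * T = T) : T * crossOp T P = crossOp T P - crossOp T P * T := by
  have hT' : ∀ z, T * (T * z) = T * z := fun z => by rw [← mul_assoc, hT]
  simp only [crossOp, mul_sub, sub_mul, mul_assoc, hT, hT']
  abel

/-- Together with `sub_mul_right`: D is (1 - c) + J on tangent vectors and the negative of that on
normal vectors. This sign difference creates the eigenvalue gap x j - x i in `idem_commutator`. -/
theorem sub_mul_left (hT : T * T = T) (hP : P * P = P) :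
    (P + T - 1) * T = (1 - angleOp T P) * T + crossOp T P * T := by
  simp only [angleOp, crossOp, mul_add, add_mul, mul_sub, sub_mul, mul_one, one_mul, mul_assoc, hT,
    hP]
  abel

theorem sub_mul_right (hT : T * T = T) (hP : P * P = P) :
    (P + T - 1) * (1 - T) = -((1 - angleOp T P) * (1 - T) + crossOp T P * (1 - T)) := by
  simp only [angleOp, crossOp, mul_add, add_mul, mul_sub, sub_mul, mul_one, one_mul, mul_assoc, hT,
    hP]
  abel

theorem isSelfAdjoint_angleOp [StarRing 𝒜] (hT : IsSelfAdjoint T) (hP : IsSelfAdjoint P) :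
    IsSelfAdjoint (angleOp T P) := by
  have h : IsSelfAdjoint (P + T - 1) := (hP.add hT).sub (IsSelfAdjoint.one 𝒜)
  refine (IsSelfAdjoint.one 𝒜).sub ?_
  rw [IsSelfAdjoint, star_mul, h.star_eq]

theorem star_crossOp [StarRing 𝒜] (hT : IsSelfAdjoint T) (hP : IsSelfAdjoint P) :
    star (crossOp T P) = -crossOp T P := by
  simp only [crossOp, star_sub, star_mul, hT.star_eq, hP.star_eq, neg_sub]

theorem isSelfAdjoint_spectralIdempotent {𝒜 : Type*} [Ring 𝒜] [StarRing 𝒜] [Algebra ℝ 𝒜]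
    [StarModule ℝ 𝒜] {c : 𝒜} (hc : IsSelfAdjoint c) (S : Finset ℝ) (x : ℝ → ℝ) (i : ℝ) :
    IsSelfAdjoint (spectralIdempotent S x c i) := by
  unfold spectralIdempotent
  induction Lagrange.basis S x i using Polynomial.induction_on' with
  | add p q hp hq => rw [map_add]; exact hp.add hq
  | monomial n a =>
    rw [Polynomial.aeval_monomial, ← Algebra.smul_def]
    exact (IsSelfAdjoint.all a).smul (hc.pow n)

end ProjectionPair

/-! ### First-order consequences of a constant angle -/

section PointwiseIdentities

variable {E : Type*} [NormedAddCommGroup E] [InnerProductSpace ℝ E] [FiniteDimensional ℝ E]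

/-- The relations between the tangent projection `T`, a fixed projection `P`, and the first and
second covariant derivatives `β` and `W` of `T`, when the eigenvalue `x i` of `angleOp T P` is
constant. -/
structure IsConstantAngleJet (T P : E →L[ℝ] E) (β : E → E →L[ℝ] E) (W : E → E → E →L[ℝ] E)
    (S : Finset ℝ) (x : ℝ → ℝ) (i : ℝ) : Prop where
  T_mul : T * T = T
  P_mul : P * P = P
  T_sa : IsSelfAdjoint T
  P_sa : IsSelfAdjoint P
  beta_sa : ∀ v, IsSelfAdjoint (β v)
  beta_eq : ∀ v, β v = β v * T + T * β v
  beta_comm : ∀ v w, T v = v → T w = w → β v w = β w v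
  W_sa : ∀ v w, IsSelfAdjoint (W v w)
  W_eq : ∀ v w, W v w = W v w * T + T * W v w + (β v * β w + β w * β v)
  W_comm : ∀ v w, T v = v → T w = w → W v w = W w v
  codazzi : ∀ v w u, T w = w → T u = u → W v w u + β w (β v u) = W v u w + β u (β v w)
  injOn : Set.InjOn x S
  mem : i ∈ S
  ann : Polynomial.aeval (angleOp T P) (Lagrange.nodal S x) = 0
  first : ∀ v, spectralIdempotent S x (angleOp T P) i *
    ((P + T - 1) * β v + β v * (P + T - 1)) * spectralIdempotent S x (angleOp T P) i = 0
  second : ∀ v w, spectralIdempotent S x (angleOp T P) i *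
      ((P + T - 1) * W v w + W v w * (P + T - 1) + (β v * β w + β w * β v)) *
        spectralIdempotent S x (angleOp T P) i =
    spectralIdempotent S x (angleOp T P) i * ((P + T - 1) * β v + β v * (P + T - 1)) *
        reducedResolvent S x (angleOp T P) i * ((P + T - 1) * β w + β w * (P + T - 1)) *
        spectralIdempotent S x (angleOp T P) i +
      spectralIdempotent S x (angleOp T P) i * ((P + T - 1) * β w + β w * (P + T - 1)) *
        reducedResolvent S x (angleOp T P) i * ((P + T - 1) * β v + β v * (P + T - 1)) *
        spectralIdempotent S x (angleOp T P) i

theorem inner_swap {A : E →L[ℝ] E} (hA : IsSelfAdjoint A) (u v : E) :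
    inner ℝ (A u) v = inner ℝ u (A v) :=
  hA.isSymmetric u v

/-- The tangential eigenspace of `angleOp T P`. -/
def IsTangentEigen (T P : E →L[ℝ] E) (μ : ℝ) (u : E) : Prop := T u = u ∧ angleOp T P u = μ • u

theorem crossOp_inner {T P : E →L[ℝ] E} (hT : IsSelfAdjoint T) (hP : IsSelfAdjoint P) (u v : E) :
    inner ℝ (crossOp T P u) v = -inner ℝ u (crossOp T P v) := by
  have h := star_crossOp hT hP
  have h2 : (crossOp T P).adjoint = -crossOp T P := h
  rw [← ContinuousLinearMap.adjoint_inner_right, h2, neg_apply, inner_neg_right]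

omit [FiniteDimensional ℝ E] in
theorem T_crossOp_apply_of_tangent {T P : E →L[ℝ] E} (hT : T * T = T) {u : E} (hu : T u = u) :
    T (crossOp T P u) = 0 := by
  have := congrArg (· u) (mul_crossOp (P := P) hT)
  simpa only [mul_apply_eq_comp, sub_apply, hu, sub_self] using this

omit [FiniteDimensional ℝ E] in
theorem crossOp_crossOp_apply {T P : E →L[ℝ] E} (hT : T * T = T) (hP : P * P = P) {u : E} {μ : ℝ}
    (hu : angleOp T P u = μ • u) : crossOp T P (crossOp T P u) = -(μ * (1 - μ)) • u := by
  have := congrArg (· u) (crossOp_mul_crossOp hT hP)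
  simp only [mul_apply_eq_comp, sub_apply, hu, map_smul] at this
  rw [this]
  module

omit [FiniteDimensional ℝ E] in
theorem angleOp_crossOp_apply {T P : E →L[ℝ] E} (hT : T * T = T) (hP : P * P = P) {u : E} {μ : ℝ}
    (hu : angleOp T P u = μ • u) : angleOp T P (crossOp T P u) = μ • crossOp T P u := by
  have := congrArg (· u) (commute_angleOp_crossOp hT hP).eq
  simpa only [mul_apply_eq_comp, hu, map_smul] using this

namespace IsConstantAngleJet

variable {T P : E →L[ℝ] E} {β : E → E →L[ℝ] E} {W : E → E → E →L[ℝ] E} {S : Finset ℝ}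
  {x : ℝ → ℝ} {i : ℝ} (h : IsConstantAngleJet T P β W S x i)

include h

theorem idem_apply {u : E} {j : ℝ} (hj : j ∈ S) (hu : angleOp T P u = x j • u) :
    spectralIdempotent S x (angleOp T P) j u = u := by
  have h1 : spectralIdempotent S x (angleOp T P) j (angleOp T P u) =
      x j • spectralIdempotent S x (angleOp T P) j u :=
    congrArg (· u) (spectralIdempotent_mul h.ann hj)
  have hne : ∀ k ∈ S, k ≠ j → spectralIdempotent S x (angleOp T P) k u = 0 := by
    intro k hk hkj
    have h2 : spectralIdempotent S x (angleOp T P) k (angleOp T P u) =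
        x k • spectralIdempotent S x (angleOp T P) k u :=
      congrArg (· u) (spectralIdempotent_mul h.ann hk)
    rw [hu, map_smul, ← sub_eq_zero, ← sub_smul, smul_eq_zero] at h2
    exact h2.resolve_left fun h3 => hkj (h.injOn hk hj (sub_eq_zero.mp h3).symm)
  have h3 := congrArg (· u) (sum_spectralIdempotent (c := angleOp T P) h.injOn ⟨j, hj⟩)
  simp only [sum_apply, one_apply_eq_self] at h3
  rwa [Finset.sum_eq_single_of_mem j hj hne] at h3

theorem idem_sa (j : ℝ) : IsSelfAdjoint (spectralIdempotent S x (angleOp T P) j) :=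
  isSelfAdjoint_spectralIdempotent (isSelfAdjoint_angleOp h.T_sa h.P_sa) S x j

theorem angleOp_idem {j : ℝ} (hj : j ∈ S) (z : E) :
    angleOp T P (spectralIdempotent S x (angleOp T P) j z) =
      x j • spectralIdempotent S x (angleOp T P) j z :=
  congrArg (· z) (mul_spectralIdempotent h.ann hj)

theorem T_idem (j : ℝ) (z : E) : T (spectralIdempotent S x (angleOp T P) j z) =
    spectralIdempotent S x (angleOp T P) j (T z) :=
  congrArg (· z) (commute_spectralIdempotent (commute_angleOp_left h.T_mul h.P_mul)).eq.symm

theorem sub_apply_tangent {u : E} {μ : ℝ} (hu : IsTangentEigen T P μ u) :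
    (P + T - 1) u = (1 - μ) • u + crossOp T P u := by
  have := congrArg (· u) (sub_mul_left h.T_mul h.P_mul)
  simp only [mul_apply_eq_comp, hu.1, add_apply, sub_apply, one_apply_eq_self, hu.2] at this ⊢
  rw [this, sub_smul, one_smul]

theorem sub_apply_normal {z : E} {μ : ℝ} (hz : T z = 0) (hz' : angleOp T P z = μ • z) :
    (P + T - 1) z = -((1 - μ) • z + crossOp T P z) := by
  have := congrArg (· z) (sub_mul_right h.T_mul h.P_mul)
  simp only [mul_apply_eq_comp, hz, add_apply, sub_apply, neg_apply, one_apply_eq_self, hz', sub_zero]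
    at this ⊢
  rw [this, sub_smul, one_smul]

theorem T_crossOp_of_tangent {u : E} (hu : T u = u) : T (crossOp T P u) = 0 :=
  T_crossOp_apply_of_tangent h.T_mul hu

theorem T_crossOp_of_normal {u : E} (hu : T u = 0) : T (crossOp T P u) = crossOp T P u := by
  have := congrArg (· u) (mul_crossOp (P := P) h.T_mul)
  simpa only [mul_apply_eq_comp, sub_apply, hu, map_zero, sub_zero] using this

theorem crossOp_crossOp {u : E} {μ : ℝ} (hu : angleOp T P u = μ • u) :
    crossOp T P (crossOp T P u) = -(μ * (1 - μ)) • u :=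
  crossOp_crossOp_apply h.T_mul h.P_mul hu

theorem angleOp_crossOp {u : E} {μ : ℝ} (hu : angleOp T P u = μ • u) :
    angleOp T P (crossOp T P u) = μ • crossOp T P u :=
  angleOp_crossOp_apply h.T_mul h.P_mul hu

theorem T_beta_of_tangent (v : E) {u : E} (hu : T u = u) : T (β v u) = 0 := by
  have := congrArg (· u) (h.beta_eq v)
  simpa [hu] using this

theorem T_beta_of_normal (v : E) {u : E} (hu : T u = 0) : T (β v u) = β v u := by
  have := congrArg (· u) (h.beta_eq v)
  simp [hu] at this
  exact this.symm

theorem inner_tangent_normal {u z : E} (hu : T u = u) (hz : T z = 0) : inner ℝ u z = 0 := by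
  rw [← hu, inner_swap h.T_sa, hz, inner_zero_right]

/-- In ⟨(Dβ + βD)w, u⟩ the multiples of w and u in Dw and Du pair a tangent with a normal vector;
only the J parts survive. -/
theorem first_order (v : E) {w u : E} (hw : IsTangentEigen T P (x i) w)
    (hu : IsTangentEigen T P (x i) u) :
    inner ℝ (β v w) (crossOp T P u) + inner ℝ (β v u) (crossOp T P w) = 0 := by
  have h1 := congrArg (fun A : E →L[ℝ] E => inner ℝ (A w) u) (h.first v)
  simp only [mul_apply_eq_comp, h.idem_apply h.mem hw.2, zero_apply, inner_zero_left] at h1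
  have hD : IsSelfAdjoint (P + T - 1) := (h.P_sa.add h.T_sa).sub (IsSelfAdjoint.one _)
  rw [inner_swap (h.idem_sa i), h.idem_apply h.mem hu.2, add_apply, mul_apply_eq_comp, mul_apply_eq_comp,
    inner_add_left, inner_swap hD, h.sub_apply_tangent hu, h.sub_apply_tangent hw,
    inner_swap (h.beta_sa v) _ u, inner_add_left, inner_add_right, inner_smul_left,
    inner_smul_right, real_inner_comm u, h.inner_tangent_normal hu.1 (h.T_beta_of_tangent v hw.1),
    h.inner_tangent_normal hw.1 (h.T_beta_of_tangent v hu.1)] at h1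
  rw [real_inner_comm (crossOp T P w)]
  linarith

/-- A trilinear form that is symmetric in its first two arguments and skew in the last two is zero.
-/
theorem inner_beta_crossOp {a w u : E} (ha : IsTangentEigen T P (x i) a)
    (hw : IsTangentEigen T P (x i) w) (hu : IsTangentEigen T P (x i) u) :
    inner ℝ (β a w) (crossOp T P u) = 0 := by
  have h1 := h.first_order a hw hu
  have h2 := h.first_order w hu ha
  have h3 := h.first_order u ha hw
  rw [h.beta_comm a u ha.1 hu.1] at h1
  rw [h.beta_comm w u hw.1 hu.1, h.beta_comm w a hw.1 ha.1] at h2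
  linarith

/-- The component z lies in the normal half of the eigenspace, so Jz is a legitimate test vector in
the tangent half; J(Jz) is a nonzero multiple of z, and pairing gives ‖z‖² = 0. -/
theorem idem_beta (hi : x i * (1 - x i) ≠ 0) {a w : E} (ha : IsTangentEigen T P (x i) a)
    (hw : IsTangentEigen T P (x i) w) :
    spectralIdempotent S x (angleOp T P) i (β a w) = 0 := by
  set z := spectralIdempotent S x (angleOp T P) i (β a w) with hz
  have hzC : angleOp T P z = x i • z := h.angleOp_idem h.mem _
  have hzT : T z = 0 := by rw [hz, h.T_idem, h.T_beta_of_tangent a hw.1, map_zero]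
  have h1 := h.inner_beta_crossOp ha hw ⟨h.T_crossOp_of_normal hzT, h.angleOp_crossOp hzC⟩
  rw [h.crossOp_crossOp hzC, inner_smul_right, ← h.idem_apply h.mem hzC,
    ← inner_swap (h.idem_sa i), ← hz, mul_eq_zero, inner_self_eq_zero, neg_eq_zero] at h1
  exact h1.resolve_left hi

/-- `first_order` allows any direction z. For tangent z, symmetry of β moves z into the direction
slot, so the sum of the two sides is orthogonal to z. That sum is itself tangent, hence may be taken
as z. -/
theorem beta_crossOp_comm {a w : E} (ha : IsTangentEigen T P (x i) a)
    (hw : IsTangentEigen T P (x i) w) : β a (crossOp T P w) = -β w (crossOp T P a) := by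
  have htan : T (β a (crossOp T P w) + β w (crossOp T P a)) =
      β a (crossOp T P w) + β w (crossOp T P a) := by
    rw [map_add, h.T_beta_of_normal a (h.T_crossOp_of_tangent hw.1),
      h.T_beta_of_normal w (h.T_crossOp_of_tangent ha.1)]
  rw [eq_neg_iff_add_eq_zero]
  generalize hz : β a (crossOp T P w) + β w (crossOp T P a) = z at htan
  rw [← inner_self_eq_zero (𝕜 := ℝ)]
  nth_rw 1 [← hz]
  rw [inner_add_left, inner_swap (h.beta_sa a), inner_swap (h.beta_sa w),
    h.beta_comm a z ha.1 htan, h.beta_comm w z hw.1 htan, real_inner_comm (β z a),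
    real_inner_comm (β z w)]
  exact h.first_order z ha hw

theorem idem_commutator {j : ℝ} (hj : j ∈ S) (a : E) {w : E} (hw : IsTangentEigen T P (x i) w) :
    spectralIdempotent S x (angleOp T P) j (((P + T - 1) * β a + β a * (P + T - 1)) w) =
      (x j - x i) • spectralIdempotent S x (angleOp T P) j (β a w) +
        (spectralIdempotent S x (angleOp T P) j (β a (crossOp T P w)) -
          crossOp T P (spectralIdempotent S x (angleOp T P) j (β a w))) := by
  have hT : T (spectralIdempotent S x (angleOp T P) j (β a w)) = 0 := by
    rw [h.T_idem, h.T_beta_of_tangent a hw.1, map_zero]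
  have hcomm : spectralIdempotent S x (angleOp T P) j ((P + T - 1) (β a w)) =
      (P + T - 1) (spectralIdempotent S x (angleOp T P) j (β a w)) := by
    have : Commute (angleOp T P) (P + T - 1) := by
      unfold angleOp
      exact (Commute.one_left _).sub_left ((Commute.refl _).mul_left (Commute.refl _))
    exact congrArg (· (β a w)) (commute_spectralIdempotent (S := S) (x := x) (i := j) this).eq
  rw [add_apply, mul_apply_eq_comp, mul_apply_eq_comp, map_add, hcomm,
    h.sub_apply_normal hT (h.angleOp_idem hj _), h.sub_apply_tangent hw, map_add, map_smul, map_add,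
    map_smul]
  module

/-- In `idem_commutator` the multiple of e_j β_a w is normal and the bracket is tangent, so no mixed
terms occur. The summand x j (1 - x j) comes from ⟨Jy, Jz⟩ on the j-th eigenspace. -/
theorem inner_idem_commutator {j : ℝ} (hj : j ∈ S) (a b : E) {w u : E}
    (hw : IsTangentEigen T P (x i) w) (hu : IsTangentEigen T P (x i) u) :
    inner ℝ (spectralIdempotent S x (angleOp T P) j
        (((P + T - 1) * β a + β a * (P + T - 1)) w))
      (spectralIdempotent S x (angleOp T P) j
        (((P + T - 1) * β b + β b * (P + T - 1)) u)) =
    ((x j - x i) ^ 2 + x j * (1 - x j)) *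
        inner ℝ (spectralIdempotent S x (angleOp T P) j (β a w))
          (spectralIdempotent S x (angleOp T P) j (β b u)) +
      (inner ℝ (spectralIdempotent S x (angleOp T P) j (β a (crossOp T P w)))
          (spectralIdempotent S x (angleOp T P) j (β b (crossOp T P u))) -
        inner ℝ (spectralIdempotent S x (angleOp T P) j (β a (crossOp T P w)))
          (crossOp T P (spectralIdempotent S x (angleOp T P) j (β b u))) -
        inner ℝ (spectralIdempotent S x (angleOp T P) j (β b (crossOp T P u)))
          (crossOp T P (spectralIdempotent S x (angleOp T P) j (β a w)))) := by
  rw [h.idem_commutator hj a hw, h.idem_commutator hj b hu]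
  have n1 : ∀ (a : E) {w : E}, IsTangentEigen T P (x i) w →
      T (spectralIdempotent S x (angleOp T P) j (β a w)) = 0 := fun a w hw => by
    rw [h.T_idem, h.T_beta_of_tangent a hw.1, map_zero]
  have t1 : ∀ (a : E) {w : E}, IsTangentEigen T P (x i) w →
      T (spectralIdempotent S x (angleOp T P) j (β a (crossOp T P w)) -
        crossOp T P (spectralIdempotent S x (angleOp T P) j (β a w))) =
      spectralIdempotent S x (angleOp T P) j (β a (crossOp T P w)) -
        crossOp T P (spectralIdempotent S x (angleOp T P) j (β a w)) := fun a w hw => by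
    rw [map_sub, h.T_crossOp_of_normal (n1 a hw), h.T_idem,
      h.T_beta_of_normal a (h.T_crossOp_of_tangent hw.1)]
  have o1 := h.inner_tangent_normal (t1 a hw) (n1 b hu)
  have o2 := (real_inner_comm _ _).trans (h.inner_tangent_normal (t1 b hu) (n1 a hw))
  rw [inner_add_left, inner_add_right, inner_add_right, inner_smul_left, inner_smul_left,
    inner_smul_right, inner_smul_right, o1, o2]
  rw [inner_sub_left, inner_sub_right, inner_sub_right,
    crossOp_inner h.T_sa h.P_sa _ (crossOp T P _), h.crossOp_crossOp (h.angleOp_idem hj _),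
    inner_smul_right,
    real_inner_comm (spectralIdempotent S x (angleOp T P) j (β b (crossOp T P u)))
      (crossOp T P (spectralIdempotent S x (angleOp T P) j (β a w)))]
  simp only [conj_trivial]
  ring

end IsConstantAngleJet

end PointwiseIdentities

/-! ### Second-order condition and the pointwise identities -/

section PointwiseIdentities

variable {E : Type*} [NormedAddCommGroup E] [InnerProductSpace ℝ E] [FiniteDimensional ℝ E]

namespace IsConstantAngleJet

variable {T P : E →L[ℝ] E} {β : E → E →L[ℝ] E} {W : E → E → E →L[ℝ] E} {S : Finset ℝ}
  {x : ℝ → ℝ} {i : ℝ} (h : IsConstantAngleJet T P β W S x i)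

include h

theorem inner_idem {j : ℝ} (hj : j ∈ S) (y z : E) :
    inner ℝ (spectralIdempotent S x (angleOp T P) j y) z =
      inner ℝ (spectralIdempotent S x (angleOp T P) j y)
        (spectralIdempotent S x (angleOp T P) j z) := by
  rw [← inner_swap (h.idem_sa j), h.idem_apply hj (h.angleOp_idem hj y)]

theorem inner_reducedResolvent (y z : E) :
    inner ℝ (reducedResolvent S x (angleOp T P) i y) z = ∑ j ∈ S.erase i, (x i - x j)⁻¹ *
      inner ℝ (spectralIdempotent S x (angleOp T P) j y)
        (spectralIdempotent S x (angleOp T P) j z) := by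
  rw [reducedResolvent, sum_apply, sum_inner]
  refine Finset.sum_congr rfl fun j hj => ?_
  rw [smul_apply, inner_smul_left, h.inner_idem (Finset.mem_of_mem_erase hj), conj_trivial]

theorem inner_beta_beta (hi : x i * (1 - x i) ≠ 0) {a b w u : E}
    (ha : IsTangentEigen T P (x i) a) (hw : IsTangentEigen T P (x i) w) :
    inner ℝ (β a w) (β b u) = ∑ j ∈ S.erase i,
      inner ℝ (spectralIdempotent S x (angleOp T P) j (β a w))
        (spectralIdempotent S x (angleOp T P) j (β b u)) := by
  have h1 := congrArg (· (β a w)) (sub_eq_sum_erase (c := angleOp T P) h.injOn h.mem)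
  simp only [sub_apply, one_apply_eq_self, h.idem_beta hi ha hw, sub_zero, sum_apply] at h1
  conv_lhs => rw [h1]
  rw [sum_inner]
  exact Finset.sum_congr rfl fun j hj => h.inner_idem (Finset.mem_of_mem_erase hj) _ _

/-- On tangent vectors `W_eq` has the tangential block of W once on the left and twice on the right,
which solves for it. -/
theorem inner_W_tangent (a b : E) {w u : E} (hw : T w = w) (hu : T u = u) :
    inner ℝ (W a b w) u =
      -(inner ℝ (β b w) (β a u) + inner ℝ (β a w) (β b u)) := by
  have h1 := congrArg (fun A : E →L[ℝ] E => inner ℝ (A w) u) (h.W_eq a b)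
  simp only [add_apply, mul_apply_eq_comp, hw, inner_add_left, inner_swap h.T_sa, hu] at h1
  rw [inner_swap (h.beta_sa a) (β b w), inner_swap (h.beta_sa b) (β a w)] at h1
  linarith

/-- The second-order condition for the angle to be constant, on the tangential eigenspace. -/
theorem second_order (hi : x i * (1 - x i) ≠ 0) {a b w u : E}
    (ha : IsTangentEigen T P (x i) a) (hb : IsTangentEigen T P (x i) b)
    (hw : IsTangentEigen T P (x i) w) (hu : IsTangentEigen T P (x i) u) :
    inner ℝ (W a b w) (crossOp T P u) + inner ℝ (W a b u) (crossOp T P w) =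
      ∑ j ∈ S.erase i, (x i - x j)⁻¹ * (x i * (1 - x i) *
        (inner ℝ (spectralIdempotent S x (angleOp T P) j (β a w))
            (spectralIdempotent S x (angleOp T P) j (β b u)) +
          inner ℝ (spectralIdempotent S x (angleOp T P) j (β b w))
            (spectralIdempotent S x (angleOp T P) j (β a u))) +
        (inner ℝ (spectralIdempotent S x (angleOp T P) j (β a (crossOp T P w)))
            (spectralIdempotent S x (angleOp T P) j (β b (crossOp T P u))) -
          inner ℝ (spectralIdempotent S x (angleOp T P) j (β a (crossOp T P w)))
            (crossOp T P (spectralIdempotent S x (angleOp T P) j (β b u))) -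
          inner ℝ (spectralIdempotent S x (angleOp T P) j (β b (crossOp T P u)))
            (crossOp T P (spectralIdempotent S x (angleOp T P) j (β a w)))) +
        (inner ℝ (spectralIdempotent S x (angleOp T P) j (β b (crossOp T P w)))
            (spectralIdempotent S x (angleOp T P) j (β a (crossOp T P u))) -
          inner ℝ (spectralIdempotent S x (angleOp T P) j (β b (crossOp T P w)))
            (crossOp T P (spectralIdempotent S x (angleOp T P) j (β a u))) -
          inner ℝ (spectralIdempotent S x (angleOp T P) j (β a (crossOp T P u)))
            (crossOp T P (spectralIdempotent S x (angleOp T P) j (β b w))))) := by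
  have hD : IsSelfAdjoint (P + T - 1) := (h.P_sa.add h.T_sa).sub (IsSelfAdjoint.one _)
  have hc : ∀ a, IsSelfAdjoint ((P + T - 1) * β a + β a * (P + T - 1)) := fun a => by
    rw [IsSelfAdjoint, star_add, star_mul, star_mul, hD.star_eq, (h.beta_sa a).star_eq, add_comm]
  have h1 := congrArg (fun A : E →L[ℝ] E => inner ℝ (A w) u) (h.second b a)
  simp only [add_apply (_ * _ * _ * _ * _), mul_apply_eq_comp _ (spectralIdempotent _ _ _ _),
    h.idem_apply h.mem hw.2] at h1
  simp only [mul_apply_eq_comp (spectralIdempotent _ _ _ _), inner_add_left,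
    mul_apply_eq_comp (_ * _) (_ + _), mul_apply_eq_comp (_ * _) (reducedResolvent _ _ _ _),
    inner_swap (h.idem_sa i), h.idem_apply h.mem hu.2, inner_swap (hc _),
    h.inner_reducedResolvent] at h1
  -- The coefficient 2 x i - 1 is 1 from the ββ terms minus 2(1 - x i) from the tangential block of
  -- W.
  have hL : inner ℝ (((P + T - 1) * W b a + W b a * (P + T - 1) + (β b * β a + β a * β b)) w) u =
      inner ℝ (W b a w) (crossOp T P u) + inner ℝ (W b a u) (crossOp T P w) +
        (2 * x i - 1) * (inner ℝ (β a w) (β b u) + inner ℝ (β b w) (β a u)) := by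
    simp only [add_apply, mul_apply_eq_comp, inner_add_left]
    rw [inner_swap hD, h.sub_apply_tangent hu, h.sub_apply_tangent hw, map_add, map_smul,
      inner_add_left, inner_add_right, inner_smul_left, inner_smul_right, conj_trivial,
      h.inner_W_tangent b a hw.1 hu.1, inner_swap (h.W_sa b a) (crossOp T P w),
      real_inner_comm (W b a u) (crossOp T P w), inner_swap (h.beta_sa b) (β a w),
      inner_swap (h.beta_sa a) (β b w)]
    ring
  rw [hL, h.W_comm b a hb.1 ha.1, h.inner_beta_beta hi ha hw, h.inner_beta_beta hi hb hw] at h1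
  have hs : ∀ a b, (∑ j ∈ S.erase i, (x i - x j)⁻¹ *
      inner ℝ (spectralIdempotent S x (angleOp T P) j
          (((P + T - 1) * β a + β a * (P + T - 1)) w))
        (spectralIdempotent S x (angleOp T P) j
          (((P + T - 1) * β b + β b * (P + T - 1)) u))) = _ :=
    fun a b => Finset.sum_congr rfl fun j hj => by
      rw [h.inner_idem_commutator (Finset.mem_of_mem_erase hj) a b hw hu]
  rw [hs, hs, ← eq_sub_iff_add_eq, mul_add, Finset.mul_sum, Finset.mul_sum,
    ← Finset.sum_add_distrib, ← Finset.sum_add_distrib, ← Finset.sum_sub_distrib] at h1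
  rw [h1]
  refine Finset.sum_congr rfl fun j hj => ?_
  have hj' := Finset.mem_erase.mp hj
  have hne : x i - x j ≠ 0 := sub_ne_zero.mpr fun e => hj'.1 (h.injOn h.mem hj'.2 e).symm
  -- The coefficients collapse to one independent of j: (x j - x i)² + x j (1 - x j) - (2 x i - 1)(x
  -- i - x j) = x i (1 - x i).
  field_simp
  ring

/-- The ββ corrections in Codazzi are tangent, hence invisible to a normal z. With `W_comm`, the
normal part of W is symmetric in all three tangent arguments. -/
theorem codazzi_apply {v w u z : E} (hw : T w = w) (hu : T u = u) (hz : T z = 0) :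
    inner ℝ (W v w u) z = inner ℝ (W v u w) z := by
  have h1 := congrArg (fun y => inner ℝ y z) (h.codazzi v w u hw hu)
  simp only [inner_add_left] at h1
  have h2 : ∀ w u, T u = u → inner ℝ (β w (β v u)) z = 0 := fun w u hu =>
    h.inner_tangent_normal (h.T_beta_of_normal w (h.T_beta_of_tangent v hu)) hz
  rwa [h2 w u hu, h2 u w hw, add_zero, add_zero] at h1

theorem beta_crossOp_self {a : E} (ha : IsTangentEigen T P (x i) a) :
    β a (crossOp T P a) = 0 := by
  have h1 := h.beta_crossOp_comm ha ha
  rw [eq_neg_iff_add_eq_zero, ← two_smul ℝ, smul_eq_zero] at h1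
  exact h1.resolve_left two_ne_zero

/-- Both pointwise identities, before the terms are expressed through `Φ`. -/
theorem pointwise_identities (hi : x i * (1 - x i) ≠ 0) {v w : E}
    (hv : IsTangentEigen T P (x i) v) (hw : IsTangentEigen T P (x i) w) :
    (∑ j ∈ S.erase i, (x i - x j)⁻¹ * (x i * (1 - x i)) *
        (inner ℝ (spectralIdempotent S x (angleOp T P) j (β v v))
            (spectralIdempotent S x (angleOp T P) j (β w w)) -
          inner ℝ (spectralIdempotent S x (angleOp T P) j (β v w))
            (spectralIdempotent S x (angleOp T P) j (β w v))) =
      3 * ∑ j ∈ S.erase i, (x i - x j)⁻¹ *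
        (inner ℝ (spectralIdempotent S x (angleOp T P) j (β v (crossOp T P v)))
            (spectralIdempotent S x (angleOp T P) j (β w (crossOp T P w))) -
          inner ℝ (spectralIdempotent S x (angleOp T P) j (β v (crossOp T P w)))
            (spectralIdempotent S x (angleOp T P) j (β w (crossOp T P v))))) ∧
    inner ℝ (W v w w) (crossOp T P v) =
      (1 / 3) * ∑ j ∈ S.erase i, (x i - x j)⁻¹ * (x i * (1 - x i)) *
        (inner ℝ (spectralIdempotent S x (angleOp T P) j (β v v))
            (spectralIdempotent S x (angleOp T P) j (β w w)) +
          2 * ‖spectralIdempotent S x (angleOp T P) j (β v w)‖ ^ 2) +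
      2 * ∑ j ∈ S.erase i, (x i - x j)⁻¹ *
        inner ℝ (spectralIdempotent S x (angleOp T P) j (β v w))
          (crossOp T P (spectralIdempotent S x (angleOp T P) j (β w (crossOp T P v)))) := by
  have m1 := h.second_order hi hw hw hv hv
  have m2 := h.second_order hi hv hv hw hw
  have m3 := h.second_order hi hv hw hw hv
  rw [h.codazzi_apply hw.1 hv.1 (h.T_crossOp_of_tangent hv.1), h.W_comm w v hw.1 hv.1] at m1
  rw [h.codazzi_apply hv.1 hw.1 (h.T_crossOp_of_tangent hw.1)] at m2
  simp only [h.beta_crossOp_self hv, h.beta_crossOp_self hw, h.beta_crossOp_comm hv hw,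
    h.beta_comm w v hw.1 hv.1, map_zero, map_neg, inner_zero_left, inner_zero_right,
    inner_neg_left, inner_neg_right, neg_neg] at m1 m2 m3 ⊢
  simp only [← real_inner_self_eq_norm_sq, Finset.mul_sum]
  -- By the symmetry of W the left side of m1 + m2 - 2 m3 cancels.
  have hz := congrArg₂ (· - ·) (congrArg₂ (· + ·) m1 m2) (congrArg (2 * ·) m3)
  simp only [Finset.mul_sum] at hz
  rw [← Finset.sum_add_distrib, ← Finset.sum_sub_distrib] at hz
  -- The second identity uses the first: it is half of m1 plus one third of the first written as a
  -- vanishing sum.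
  refine (and_iff_left_of_imp fun h1 => ?_).mpr ?_
  · have h1' := sub_eq_zero.mpr h1
    rw [← Finset.sum_sub_distrib] at h1'
    trans (1 / 2) * (inner ℝ (W v w w) (crossOp T P v) + inner ℝ (W v w w) (crossOp T P v)) +
      (1 / 3) * 0
    · ring
    · rw [← h1', m1, Finset.mul_sum, Finset.mul_sum, ← Finset.sum_add_distrib,
        ← Finset.sum_add_distrib]
      refine Finset.sum_congr rfl fun j _ => ?_
      rw [← neg_neg (inner ℝ (spectralIdempotent S x (angleOp T P) j (β v w)) (crossOp T P _)),
        ← crossOp_inner h.T_sa h.P_sa,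
        real_inner_comm (spectralIdempotent S x (angleOp T P) j (β w (crossOp T P v)))
          (crossOp T P _)]
      ring
  · rw [← sub_eq_zero, ← Finset.sum_sub_distrib]
    trans (-1 / 2) * (inner ℝ (W v w w) (crossOp T P v) + inner ℝ (W v w w) (crossOp T P v) +
      (inner ℝ (W v w v) (crossOp T P w) + inner ℝ (W v w v) (crossOp T P w)) -
      2 * (inner ℝ (W v w w) (crossOp T P v) + inner ℝ (W v w v) (crossOp T P w)))
    · rw [hz, Finset.mul_sum]
      refine Finset.sum_congr rfl fun j _ => ?_
      rw [real_inner_comm (spectralIdempotent S x (angleOp T P) j (β v v))]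
      ring
    · ring

end IsConstantAngleJet

end PointwiseIdentities

/-! ### Angle spaces as eigenspaces, and the annihilating polynomial -/

section AngleSpaces

variable {E : Type*} [NormedAddCommGroup E] [InnerProductSpace ℝ E] [FiniteDimensional ℝ E]

theorem starProjection_orthogonal_eq (K : Submodule ℝ E) :
    Kᗮ.starProjection = 1 - K.starProjection := by
  ext u
  rw [Submodule.starProjection_orthogonal_val]
  rfl

theorem starProjection_mul_self (K : Submodule ℝ E) :
    K.starProjection * K.starProjection = K.starProjection :=
  Submodule.isIdempotentElem_starProjection _

theorem mem_iff_starProjection {K : Submodule ℝ E} {u : E} : u ∈ K ↔ K.starProjection u = u :=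
  Submodule.starProjection_eq_self_iff.symm

theorem mem_orthogonal_iff_starProjection {K : Submodule ℝ E} {u : E} :
    u ∈ Kᗮ ↔ K.starProjection u = 0 :=
  (Submodule.starProjection_apply_eq_zero_iff K).symm

omit [FiniteDimensional ℝ E] in
theorem angleOp_apply {T P : E →L[ℝ] E} (hT : T * T = T) (hP : P * P = P) (u : E) :
    angleOp T P u = P u + T u - P (T u) - T (P u) := by
  have h : angleOp T P = P + T - P * T - T * P := by
    simp only [angleOp, mul_add, add_mul, mul_sub, sub_mul, mul_one, one_mul, hT, hP]
    abel
  rw [h]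
  rfl

/-- For u in K the expansion Pu + Tu - PTu - TPu of c u reduces to u - TPu = T(P⊥u). In
`mem_angleSpace_normal` it reduces to (1 - T)Pu. -/
theorem mem_angleSpace_tangent {K Q : Submodule ℝ E} {θ : ℝ} {u : E} :
    u ∈ angleSpace K Qᗮ θ ↔
      IsTangentEigen K.starProjection Q.starProjection (Real.cos θ ^ 2) u := by
  change u ∈ K ∧ K.starProjection (Qᗮ.starProjection u) = _ ↔ _
  rw [mem_iff_starProjection, IsTangentEigen]
  refine and_congr_right fun hu => ?_
  rw [angleOp_apply (starProjection_mul_self K) (starProjection_mul_self Q),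
    starProjection_orthogonal_eq, hu, sub_apply, one_apply_eq_self, map_sub, hu, add_sub_cancel_left]

theorem mem_angleSpace_normal {K Q : Submodule ℝ E} {θ : ℝ} {u : E} :
    u ∈ angleSpace Kᗮ Q θ ↔ K.starProjection u = 0 ∧
      angleOp K.starProjection Q.starProjection u = Real.cos θ ^ 2 • u := by
  change u ∈ Kᗮ ∧ Kᗮ.starProjection (Q.starProjection u) = _ ↔ _
  rw [mem_orthogonal_iff_starProjection]
  refine and_congr_right fun hu => ?_
  rw [angleOp_apply (starProjection_mul_self K) (starProjection_mul_self Q),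
    starProjection_orthogonal_eq, hu, map_zero, add_zero, sub_zero, sub_apply, one_apply_eq_self]

theorem mem_jordanAngleFinset {P Q : Submodule ℝ E} {θ : ℝ} : θ ∈ jordanAngleFinset P Q ↔
    0 ≤ θ ∧ θ ≤ Real.pi / 2 ∧ angleSpace P Q θ ≠ ⊥ :=
  Set.Finite.mem_toFinset _

theorem cos_sq_injOn : Set.InjOn (fun θ : ℝ => Real.cos θ ^ 2) (Set.Icc 0 (Real.pi / 2)) := by
  rintro a ⟨ha0, ha1⟩ b ⟨hb0, hb1⟩ hab
  have hpi := Real.pi_pos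
  have ha : 0 ≤ Real.cos a := Real.cos_nonneg_of_mem_Icc ⟨by linarith, ha1⟩
  have hb : 0 ≤ Real.cos b := Real.cos_nonneg_of_mem_Icc ⟨by linarith, hb1⟩
  exact Real.injOn_cos ⟨ha0, by linarith⟩ ⟨hb0, by linarith⟩ ((sq_eq_sq₀ ha hb).mp hab)

theorem inner_crossOp_self {T P : E →L[ℝ] E} (hT : T * T = T) (hP : P * P = P)
    (hT' : IsSelfAdjoint T) (hP' : IsSelfAdjoint P) {u : E} {μ : ℝ} (hu : angleOp T P u = μ • u) :
    ‖crossOp T P u‖ ^ 2 = μ * (1 - μ) * ‖u‖ ^ 2 := by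
  rw [← real_inner_self_eq_norm_sq, crossOp_inner hT' hP', crossOp_crossOp_apply hT hP hu,
    inner_smul_right, real_inner_self_eq_norm_sq]
  ring

/-- A tangential angle in `(0, π/2)` is a normal angle. -/
theorem angleSpace_normal_ne_bot {K Q : Submodule ℝ E} {θ : ℝ} (h0 : 0 < θ)
    (h1 : θ < Real.pi / 2) (h : angleSpace K Qᗮ θ ≠ ⊥) : angleSpace Kᗮ Q θ ≠ ⊥ := by
  obtain ⟨u, hu, hu0⟩ := Submodule.exists_mem_ne_zero_of_ne_bot h
  rw [mem_angleSpace_tangent] at hu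
  have hK := starProjection_mul_self K
  have hQ := starProjection_mul_self Q
  refine Submodule.ne_bot_iff _ |>.mpr
    ⟨crossOp K.starProjection Q.starProjection u, mem_angleSpace_normal.mpr
      ⟨T_crossOp_apply_of_tangent hK hu.1, angleOp_crossOp_apply hK hQ hu.2⟩, fun h2 => ?_⟩
  have h3 := inner_crossOp_self hK hQ (isSelfAdjoint_starProjection K)
    (isSelfAdjoint_starProjection Q) hu.2
  have hc : 0 < Real.cos θ := Real.cos_pos_of_mem_Ioo ⟨by linarith, h1⟩
  have hs : 0 < Real.sin θ := Real.sin_pos_of_pos_of_lt_pi h0 (by linarith)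
  have hs2 : 1 - Real.cos θ ^ 2 = Real.sin θ ^ 2 := by rw [Real.sin_sq]
  rw [h2, norm_zero, hs2] at h3
  have : 0 < ‖u‖ := norm_pos_iff.mpr hu0
  have h4 : 0 < Real.cos θ ^ 2 * Real.sin θ ^ 2 * ‖u‖ ^ 2 := by positivity
  rw [← h3] at h4
  simp at h4

omit [FiniteDimensional ℝ E] in
theorem aeval_apply_of_eigen {A : E →L[ℝ] E} {u : E} {μ : ℝ} (hu : A u = μ • u)
    (p : Polynomial ℝ) : Polynomial.aeval A p u = p.eval μ • u := by
  induction p using Polynomial.induction_on' with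
  | add p q hp hq => rw [map_add, add_apply, hp, hq, Polynomial.eval_add, add_smul]
  | monomial n a =>
    have : (A ^ n) u = μ ^ n • u := by
      induction n with
      | zero => simp
      | succ k ih => rw [pow_succ, mul_apply_eq_comp, hu, map_smul, ih, smul_smul, pow_succ']
    rw [Polynomial.aeval_monomial, ← Algebra.smul_def, smul_apply, this, Polynomial.eval_monomial,
      mul_smul]

/-- `angleOp` is annihilated by the polynomial whose roots are the `cos²` of the normal angles,
together with `0` and `1`. -/
theorem aeval_angleOp_eq_zero (K Q : Submodule ℝ E) (S : Finset ℝ)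
    (hS : jordanAngleFinset Kᗮ Q ⊆ S) (h0 : 0 ∈ S) (h1 : Real.pi / 2 ∈ S) :
    Polynomial.aeval (angleOp K.starProjection Q.starProjection)
      (Lagrange.nodal S fun θ => Real.cos θ ^ 2) = 0 := by
  set T := K.starProjection with hTdef
  set P := Q.starProjection with hPdef
  have hT : T * T = T := starProjection_mul_self K
  have hP : P * P = P := starProjection_mul_self Q
  have hT' : IsSelfAdjoint T := isSelfAdjoint_starProjection K
  have hP' : IsSelfAdjoint P := isSelfAdjoint_starProjection Q
  have hroot : ∀ (μ : ℝ) (u : E), angleOp T P u = μ • u → u ≠ 0 →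
      (Lagrange.nodal S fun θ => Real.cos θ ^ 2).eval μ = 0 := by
    intro μ u hu hu0
    suffices h : ∃ θ ∈ S, Real.cos θ ^ 2 = μ by
      obtain ⟨θ, hθ, rfl⟩ := h
      exact Lagrange.eval_nodal_at_node (v := fun θ => Real.cos θ ^ 2) hθ
    have hJ := inner_crossOp_self hT hP hT' hP' hu
    have hupos : 0 < ‖u‖ ^ 2 := by
      have := norm_pos_iff.mpr hu0
      positivity
    -- ‖Ju‖² = μ(1 - μ)‖u‖² confines every eigenvalue to [0, 1].
    have hμ : 0 ≤ μ * (1 - μ) := by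
      by_contra hneg
      have : μ * (1 - μ) * ‖u‖ ^ 2 < 0 := mul_neg_of_neg_of_pos (not_le.mp hneg) hupos
      rw [← hJ] at this
      exact absurd (sq_nonneg _) (not_le.mpr this)
    have hμ0 : 0 ≤ μ := by nlinarith
    have hμ1 : μ ≤ 1 := by nlinarith
    -- The eigenvalues 0 and 1 may occur only on tangent vectors, where J vanishes and yields no
    -- normal eigenvector; hence the extra nodes π/2 and 0.
    rcases hμ0.eq_or_lt with rfl | hμ0'
    · exact ⟨_, h1, by simp⟩
    rcases hμ1.eq_or_lt with rfl | hμ1'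
    · exact ⟨_, h0, by simp⟩
    have hcos : Real.cos (Real.arccos (Real.sqrt μ)) ^ 2 = μ := by
      rw [Real.cos_arccos (by linarith [Real.sqrt_nonneg μ]) (Real.sqrt_le_one.mpr hμ1),
        Real.sq_sqrt hμ0]
    refine ⟨Real.arccos (Real.sqrt μ), hS (mem_jordanAngleFinset.mpr ⟨Real.arccos_nonneg _,
      Real.arccos_le_pi_div_two.mpr (Real.sqrt_nonneg μ), ?_⟩), hcos⟩
    rw [Submodule.ne_bot_iff]
    -- A normal eigenvector is the normal part of u, or Ju if u is tangent.
    by_cases hNu : u - T u = 0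
    · have hTu : T u = u := (sub_eq_zero.mp hNu).symm
      refine ⟨crossOp T P u, mem_angleSpace_normal.mpr ⟨T_crossOp_apply_of_tangent hT hTu, ?_⟩, ?_⟩
      · rw [hcos]
        exact angleOp_crossOp_apply hT hP hu
      · intro hz
        rw [hz, norm_zero] at hJ
        have : 0 < μ * (1 - μ) * ‖u‖ ^ 2 := mul_pos (mul_pos hμ0' (by linarith)) hupos
        rw [← hJ] at this
        simp at this
    · refine ⟨u - T u, mem_angleSpace_normal.mpr ⟨?_, ?_⟩, hNu⟩
      · rw [map_sub, ← hTdef, ← mul_apply_eq_comp, hT, sub_self]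
      · have hc := congrArg (· u) (commute_angleOp_left hT hP).eq
        simp only [mul_apply_eq_comp, hu, map_smul] at hc
        rw [hcos, map_sub, hu, hc, smul_sub]
  have hsym : (angleOp T P).toLinearMap.IsSymmetric := (isSelfAdjoint_angleOp hT' hP').isSymmetric
  -- c is symmetric, so its eigenvectors span and the polynomial need only be checked on them.
  have htop : (⨆ μ : ℝ, Module.End.eigenspace (angleOp T P).toLinearMap μ) = ⊤ := by
    have := hsym.orthogonalComplement_iSup_eigenspaces_eq_bot
    rwa [Submodule.orthogonal_eq_bot_iff] at this
  ext u
  have hu : u ∈ ⨆ μ : ℝ, Module.End.eigenspace (angleOp T P).toLinearMap μ := htop ▸ trivial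
  induction hu using Submodule.iSup_induction' with
  | mem μ u hu =>
    by_cases hu0 : u = 0
    · rw [hu0, map_zero, map_zero]
    · have hu' : angleOp T P u = μ • u := Module.End.mem_eigenspace_iff.mp hu
      rw [aeval_apply_of_eigen hu', hroot μ u hu' hu0, zero_smul, zero_apply]
  | zero => rw [map_zero, map_zero]
  | add u v _ _ h1 h2 => rw [map_add, map_add, h1, h2]

end AngleSpaces

/-! ### Differentiating the angle operator of a local immersion -/

section LocalJet

variable {V E : Type*} [NormedAddCommGroup V] [InnerProductSpace ℝ V] [FiniteDimensional ℝ V]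
  [NormedAddCommGroup E] [InnerProductSpace ℝ E] [FiniteDimensional ℝ E]
  {G : V → E} {U : Set V} {y : V}

theorem hasFDerivAt_sub_localProj (P : E →L[ℝ] E) (hd : DifferentiableAt ℝ (localProj G) y) :
    HasFDerivAt (fun z => P + localProj G z - 1) (fderiv ℝ (localProj G) y) y :=
  (hd.hasFDerivAt.const_add P).sub_const 1

theorem fderiv_angleOp_localProj (P : E →L[ℝ] E) (hd : DifferentiableAt ℝ (localProj G) y)
    (v : E) : fderiv ℝ (fun z => angleOp (localProj G z) P) y (pinv (fderiv ℝ G y) v) =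
      -((P + localProj G y - 1) * localB G v y + localB G v y * (P + localProj G y - 1)) := by
  have h1 := hasFDerivAt_sub_localProj P hd
  have h2 := ((h1.mul' h1).const_sub 1).fderiv
  change fderiv ℝ (fun z => angleOp (localProj G z) P) y = _ at h2
  rw [h2]
  rfl

variable (hU : IsOpen U) (hG : ContDiffOn ℝ ∞ G U)
  (hinj : ∀ y ∈ U, Function.Injective (fderiv ℝ G y)) (hy : y ∈ U)

include hU hG hinj hy

theorem isConstantAngleJet_local {P : E →L[ℝ] E} (hP : P * P = P) (hP' : IsSelfAdjoint P)
    {S : Finset ℝ} {x : ℝ → ℝ} {i : ℝ} (hx : Set.InjOn x S) (hi : i ∈ S)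
    (hann : ∀ z ∈ U, Polynomial.aeval (angleOp (localProj G z) P) (Lagrange.nodal S x) = 0) :
    IsConstantAngleJet (localProj G y) P (fun v => localB G v y) (fun v w => localW G v w y)
      S x i := by
  have hdT : ∀ z ∈ U, DifferentiableAt ℝ (localProj G) z :=
    fun z hz => differentiableAt_localProj hU hG hinj hz
  have hd : ∀ z ∈ U, DifferentiableAt ℝ (fun z => angleOp (localProj G z) P) z := fun z hz => by
    have h1 := hasFDerivAt_sub_localProj P (hdT z hz)
    exact ((h1.mul' h1).const_sub 1).differentiableAt
  have hann' : ∀ᶠ z in nhds y,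
      Polynomial.aeval (angleOp (localProj G z) P) (Lagrange.nodal S x) = 0 :=
    Filter.mem_of_superset (hU.mem_nhds hy) hann
  refine
    { T_mul := localProj_mul_self (hinj y hy)
      P_mul := hP
      T_sa := isSelfAdjoint_localProj (hinj y hy)
      P_sa := hP'
      beta_sa := fun v => isSelfAdjoint_localB hU hG hinj hy v
      beta_eq := fun v => localB_eq hU hG hinj hy v
      beta_comm := fun v w hv hw => by
        have := localB_comm hU hG hinj hy v w
        rwa [hv, hw] at this
      W_sa := fun v w => isSelfAdjoint_localW hU hG hinj hy v w
      W_eq := fun v w => localW_eq hU hG hinj hy v w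
      W_comm := fun v w hv hw => localW_comm hU hG hinj hy v w hv hw
      codazzi := fun v w u hw hu => localW_apply_comm hU hG hinj hy v w u hw hu
      injOn := hx
      mem := hi
      ann := hann y hy
      first := fun v => ?_
      second := fun v w => ?_ }
  · have h := (spectralIdempotent_fderiv hann' hi (hd y hy) (pinv (fderiv ℝ G y) v)).1
    rw [fderiv_angleOp_localProj P (hdT y hy), mul_neg, neg_mul, neg_eq_zero] at h
    exact h
  · have hB := differentiableAt_localB hU hG hinj hy w
    have hD := hasFDerivAt_sub_localProj P (hdT y hy)
    -- The direction is the moving field `pinv (fderiv ℝ G z) w`, so that c′ along it is -(Dβ_w +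
    -- β_w D) near y and the derivative of β_w along v is exactly W.
    have heq : (fun z => fderiv ℝ (fun z => angleOp (localProj G z) P) z (pinv (fderiv ℝ G z) w))
        =ᶠ[nhds y] fun z => -((P + localProj G z - 1) * localB G w z +
          localB G w z * (P + localProj G z - 1)) := by
      filter_upwards [hU.mem_nhds hy] with z hz using fderiv_angleOp_localProj P (hdT z hz) w
    have hder := ((hD.mul' hB.hasFDerivAt).add (hB.hasFDerivAt.mul' hD)).neg
    have hdiff : DifferentiableAt ℝ (fun z => fderiv ℝ (fun z => angleOp (localProj G z) P) z
        (pinv (fderiv ℝ G z) w)) y := (heq.differentiableAt_iff).mpr hder.differentiableAt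
    have h := spectralIdempotent_fderiv_fderiv hann' hx hi
      (Filter.mem_of_superset (hU.mem_nhds hy) hd) (fun z => pinv (fderiv ℝ G z) w) hdiff
      (pinv (fderiv ℝ G y) v)
    simp only [fderiv_angleOp_localProj P (hdT y hy)] at h
    have h2 : fderiv ℝ (fun z => fderiv ℝ (fun z => angleOp (localProj G z) P) z
        (pinv (fderiv ℝ G z) w)) y (pinv (fderiv ℝ G y) v) =
        -((P + localProj G y - 1) * localW G v w y + localW G v w y * (P + localProj G y - 1) +
          (localB G v y * localB G w y + localB G w y * localB G v y)) := by
      rw [heq.fderiv_eq]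
      refine (congrArg (· (pinv (fderiv ℝ G y) v)) hder.fderiv).trans ?_
      change -(((P + localProj G y - 1) * localW G v w y + localB G v y * localB G w y) +
        (localB G w y * localB G v y + localW G v w y * (P + localProj G y - 1))) = _
      abel
    rw [h2] at h
    simp only [mul_neg, neg_mul, neg_neg, neg_inj] at h
    exact h

/-- The derivative of the second fundamental form along tangential extensions. -/
theorem fderiv_second_fundamental (v a b : E)
    (hb : localProj G y b = b) :
    (1 - localProj G y) (fderiv ℝ
      (fun z => (1 - localProj G z) (localB G (localProj G z a) z (localProj G z b))) y
      (pinv (fderiv ℝ G y) v)) = (1 - localProj G y) (localW G v a y b) := by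
  have hT := differentiableAt_localProj hU hG hinj hy
  have hB := differentiableAt_localB hU hG hinj hy a
  have heq : (fun z => (1 - localProj G z) (localB G (localProj G z a) z (localProj G z b)))
      =ᶠ[nhds y] fun z => (1 - localProj G z) (localB G a z (localProj G z b)) := by
    filter_upwards [hU.mem_nhds hy] with z hz
    rw [localB_localProj (hinj z hz)]
  have h1 := hT.hasFDerivAt.clm_apply (hasFDerivAt_const b y)
  have h2 := hB.hasFDerivAt.clm_apply h1
  have h3 := (hT.hasFDerivAt.const_sub 1).clm_apply h2
  have hT2 : ∀ z, localProj G y (localProj G y z) = localProj G y z := fun z =>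
    congrArg (· z) (localProj_mul_self (hinj y hy))
  have hBn : ∀ v u, localProj G y u = u → localProj G y (localB G v y u) = 0 :=
    fun v u hu => localProj_localB hU hG hinj hy v hu
  have hBt : ∀ v u, localProj G y u = 0 → localProj G y (localB G v y u) = localB G v y u :=
    fun v u hu => by
      have := congrArg (· u) (localB_eq hU hG hinj hy v)
      simp [hu] at this
      exact this.symm
  rw [heq.fderiv_eq]
  have e1 : fderiv ℝ (localProj G) y (pinv (fderiv ℝ G y) v) = localB G v y := rfl
  have e2 : fderiv ℝ (localB G a) y (pinv (fderiv ℝ G y) v) = localW G v a y := rfl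
  rw [h3.fderiv]
  -- The product rule also gives β_v β_a b and β_a β_v b; both are tangent and die under 1 - T.
  simp [e1, e2, hb, hT2, hBt _ _ (hBn a b hb), hBt _ _ (hBn v b hb)]

end LocalJet

/-! ### Reading the immersion in a chart -/

section Charts

theorem starProjection_congr {E : Type*} [NormedAddCommGroup E] [InnerProductSpace ℝ E]
    [FiniteDimensional ℝ E] {K L : Submodule ℝ E} (h : K = L) :
    K.starProjection = L.starProjection := by
  subst h
  rfl

variable {n : ℕ} {E : Type*} [NormedAddCommGroup E] [InnerProductSpace ℝ E]
  [FiniteDimensional ℝ E] {M : Type*} [TopologicalSpace M]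
  [ChartedSpace (EuclideanSpace ℝ (Fin n)) M]

/-- The map `F` read in the chart at `p`. -/
def chartRep (F : M → E) (p : M) : EuclideanSpace ℝ (Fin n) → E :=
  F ∘ (extChartAt (𝓡 n) p).symm

variable {F : M → E} {p q : M}

omit [NormedAddCommGroup E] [InnerProductSpace ℝ E] [FiniteDimensional ℝ E] in
theorem eventuallyEq_comp_chart (X : M → E) (hq : q ∈ (extChartAt (𝓡 n) p).source) :
    X =ᶠ[nhds q] chartRep X p ∘ extChartAt (𝓡 n) p := by
  filter_upwards [extChartAt_source_mem_nhds' (I := 𝓡 n) hq] with r hr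
  simp only [chartRep, Function.comp_apply, (extChartAt (𝓡 n) p).left_inv hr]

variable [IsManifold (𝓡 n) ∞ M]

omit [FiniteDimensional ℝ E] in
theorem differential_eq_of_eventuallyEq {X : M → E} {Y : EuclideanSpace ℝ (Fin n) → E}
    (hq : q ∈ (extChartAt (𝓡 n) p).source) (hXY : X =ᶠ[nhds q] Y ∘ extChartAt (𝓡 n) p)
    (hY : DifferentiableAt ℝ Y (extChartAt (𝓡 n) p q)) (ξ : TangentSpace (𝓡 n) q) :
    differential (n := n) X q ξ = fderiv ℝ Y (extChartAt (𝓡 n) p q)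
      (mfderiv (𝓡 n) 𝓘(ℝ, EuclideanSpace ℝ (Fin n)) (extChartAt (𝓡 n) p) q ξ) := by
  have h1 : MDifferentiableAt (𝓡 n) 𝓘(ℝ, EuclideanSpace ℝ (Fin n)) (extChartAt (𝓡 n) p) q :=
    mdifferentiableAt_extChartAt (by simpa using hq)
  rw [differential, hXY.mfderiv_eq, mfderiv_comp q hY.mdifferentiableAt h1, mfderiv_eq_fderiv]
  rfl

theorem mfderiv_chart_surjective (hq : q ∈ (extChartAt (𝓡 n) p).source)
    (η : EuclideanSpace ℝ (Fin n)) : ∃ ξ : TangentSpace (𝓡 n) q,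
      mfderiv (𝓡 n) 𝓘(ℝ, EuclideanSpace ℝ (Fin n)) (extChartAt (𝓡 n) p) q ξ = η := by
  obtain ⟨e, he⟩ := isInvertible_mfderiv_extChartAt (I := 𝓡 n) hq
  refine ⟨e.symm η, ?_⟩
  rw [← he]
  exact e.apply_symm_apply η

variable (hF : ContMDiff (𝓡 n) 𝓘(ℝ, E) ∞ F)
  (himm : ∀ p : M, Function.Injective (differential (n := n) F p))

include hF

omit [FiniteDimensional ℝ E] in
theorem contDiffOn_chartRep (p : M) :
    ContDiffOn ℝ ∞ (chartRep (n := n) F p) (extChartAt (𝓡 n) p).target :=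
  contMDiffOn_iff_contDiffOn.mp (hF.comp_contMDiffOn (contMDiffOn_extChartAt_symm p))

omit [FiniteDimensional ℝ E] in
theorem differential_eq (hq : q ∈ (extChartAt (𝓡 n) p).source) (ξ : TangentSpace (𝓡 n) q) :
    differential (n := n) F q ξ = fderiv ℝ (chartRep (n := n) F p) (extChartAt (𝓡 n) p q)
      (mfderiv (𝓡 n) 𝓘(ℝ, EuclideanSpace ℝ (Fin n)) (extChartAt (𝓡 n) p) q ξ) :=
  differential_eq_of_eventuallyEq hq (eventuallyEq_comp_chart F hq)
    (((contDiffOn_chartRep hF p).contDiffAt ((isOpen_extChartAt_target p).mem_nhds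
      ((extChartAt (𝓡 n) p).map_source hq))).differentiableAt (by simp)) ξ

omit [FiniteDimensional ℝ E] in
theorem tangentPlane_eq (hq : q ∈ (extChartAt (𝓡 n) p).source) :
    tangentPlane (n := n) F q = LinearMap.range
      (fderiv ℝ (chartRep (n := n) F p) (extChartAt (𝓡 n) p q)).toLinearMap := by
  ext z
  constructor
  · rintro ⟨ξ, rfl⟩
    exact ⟨_, (differential_eq hF hq ξ).symm⟩
  · rintro ⟨η, rfl⟩
    obtain ⟨ξ, rfl⟩ := mfderiv_chart_surjective hq η
    exact ⟨ξ, differential_eq hF hq ξ⟩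

include himm

omit [FiniteDimensional ℝ E] in
theorem fderiv_chartRep_injective (p : M) :
    ∀ y ∈ (extChartAt (𝓡 n) p).target,
      Function.Injective (fderiv ℝ (chartRep (n := n) F p) y) := by
  suffices h : ∀ q ∈ (extChartAt (𝓡 n) p).source,
      Function.Injective (fderiv ℝ (chartRep (n := n) F p) (extChartAt (𝓡 n) p q)) by
    intro y hy
    have := h _ ((extChartAt (𝓡 n) p).map_target hy)
    rwa [(extChartAt (𝓡 n) p).right_inv hy] at this
  intro q hq a b hab
  obtain ⟨ξ, hξ⟩ := mfderiv_chart_surjective hq a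
  obtain ⟨η, hη⟩ := mfderiv_chart_surjective hq b
  have h1 := (differential_eq hF hq ξ).trans
    (congrArg (fderiv ℝ (chartRep (n := n) F p) (extChartAt (𝓡 n) p q)) hξ)
  have h2 := (differential_eq hF hq η).trans
    (congrArg (fderiv ℝ (chartRep (n := n) F p) (extChartAt (𝓡 n) p q)) hη)
  have := himm _ (h1.trans (hab.trans h2.symm))
  rw [← hξ, ← hη, this]

theorem projT_eq (hq : q ∈ (extChartAt (𝓡 n) p).source) :
    projT (n := n) F q = localProj (chartRep (n := n) F p) (extChartAt (𝓡 n) p q) := by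
  rw [localProj_eq (fderiv_chartRep_injective hF himm p _
    ((extChartAt (𝓡 n) p).map_source hq))]
  exact starProjection_congr (tangentPlane_eq hF hq)

theorem mfderiv_chart_tangentLift (hq : q ∈ (extChartAt (𝓡 n) p).source) (v : E) :
    mfderiv (𝓡 n) 𝓘(ℝ, EuclideanSpace ℝ (Fin n)) (extChartAt (𝓡 n) p) q
      (tangentLift (n := n) F q v) =
        pinv (fderiv ℝ (chartRep (n := n) F p) (extChartAt (𝓡 n) p q)) v := by
  have hinj := fderiv_chartRep_injective hF himm p _ ((extChartAt (𝓡 n) p).map_source hq)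
  apply hinj
  rw [← differential_eq hF hq]
  refine Eq.trans ?_ (congrArg (· v) (projT_eq hF himm hq))
  obtain ⟨ξ, hξ⟩ : projT (n := n) F q v ∈ tangentPlane (n := n) F q :=
    Submodule.starProjection_apply_mem _ _
  have hker : LinearMap.ker (differential (n := n) F q).toLinearMap = ⊥ :=
    LinearMap.ker_eq_bot.mpr (himm q)
  rw [tangentLift]
  change _ = projT (n := n) F q v
  rw [← hξ, LinearMap.leftInverse_apply_of_inj hker]
  rfl

theorem flatDeriv_eq {X : M → E} {Y : EuclideanSpace ℝ (Fin n) → E}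
    (hq : q ∈ (extChartAt (𝓡 n) p).source)
    (hXY : ∀ r ∈ (extChartAt (𝓡 n) p).source, X r = Y (extChartAt (𝓡 n) p r))
    (hY : DifferentiableAt ℝ Y (extChartAt (𝓡 n) p q)) (v : E) :
    flatDeriv (n := n) F q v X = fderiv ℝ Y (extChartAt (𝓡 n) p q)
      (pinv (fderiv ℝ (chartRep (n := n) F p) (extChartAt (𝓡 n) p q)) v) := by
  rw [flatDeriv, differential_eq_of_eventuallyEq hq
    (Filter.mem_of_superset (extChartAt_source_mem_nhds' hq) hXY) hY,
    mfderiv_chart_tangentLift hF himm hq]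

end Charts

/-! ### Second fundamental form, shape operator and ∇B in a chart -/

section Charts

variable {n : ℕ} {E : Type*} [NormedAddCommGroup E] [InnerProductSpace ℝ E]
  [FiniteDimensional ℝ E] {M : Type*} [TopologicalSpace M]
  [ChartedSpace (EuclideanSpace ℝ (Fin n)) M] [IsManifold (𝓡 n) ∞ M] {F : M → E} {p q : M}
  (hF : ContMDiff (𝓡 n) 𝓘(ℝ, E) ∞ F)
  (himm : ∀ p : M, Function.Injective (differential (n := n) F p))

include hF himm

theorem projN_eq (hq : q ∈ (extChartAt (𝓡 n) p).source) :
    projN (n := n) F q = 1 - localProj (chartRep (n := n) F p) (extChartAt (𝓡 n) p q) := by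
  rw [← projT_eq hF himm hq]
  exact starProjection_orthogonal_eq _

theorem differentiableAt_localProj_chart (hq : q ∈ (extChartAt (𝓡 n) p).source) :
    DifferentiableAt ℝ (localProj (chartRep (n := n) F p)) (extChartAt (𝓡 n) p q) :=
  differentiableAt_localProj (isOpen_extChartAt_target p) (contDiffOn_chartRep hF p)
    (fderiv_chartRep_injective hF himm p) ((extChartAt (𝓡 n) p).map_source hq)

theorem flatDeriv_tangentExtension (hq : q ∈ (extChartAt (𝓡 n) p).source) (v w : E) :
    flatDeriv (n := n) F q v (tangentExtension (n := n) F w) =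
      localB (chartRep (n := n) F p) v (extChartAt (𝓡 n) p q) w := by
  have hd := differentiableAt_localProj_chart hF himm hq
  rw [flatDeriv_eq (Y := fun z => localProj (chartRep (n := n) F p) z w) hF himm hq
    (fun r hr => by rw [tangentExtension, projT_eq hF himm hr])
    (hd.clm_apply (differentiableAt_const w)), fderiv_clm_apply hd (differentiableAt_const w)]
  simp [localB, tderiv]

theorem secondFundamentalForm_eq (hq : q ∈ (extChartAt (𝓡 n) p).source) (v w : E) :
    secondFundamentalForm (n := n) F q v w =
      (1 - localProj (chartRep (n := n) F p) (extChartAt (𝓡 n) p q))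
        (localB (chartRep (n := n) F p) v (extChartAt (𝓡 n) p q) w) := by
  rw [secondFundamentalForm, flatDeriv_tangentExtension hF himm hq, projN_eq hF himm hq]

/-- The derivative of the normal projection 1 - T is -β, which absorbs the minus sign of the shape
operator. -/
theorem shapeOperator_eq (hq : q ∈ (extChartAt (𝓡 n) p).source) (ν v : E) :
    shapeOperator (n := n) F q ν v =
      localProj (chartRep (n := n) F p) (extChartAt (𝓡 n) p q)
        (localB (chartRep (n := n) F p) v (extChartAt (𝓡 n) p q) ν) := by
  have hd := differentiableAt_localProj_chart hF himm hq
  have hd' := hd.const_sub (1 : E →L[ℝ] E)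
  rw [shapeOperator, flatDeriv_eq (Y := fun z => (1 - localProj (chartRep (n := n) F p) z) ν) hF
    himm hq (fun r hr => by rw [normalExtension, projN_eq hF himm hr])
    (hd'.clm_apply (differentiableAt_const ν)), fderiv_clm_apply hd' (differentiableAt_const ν),
    projT_eq hF himm hq, fderiv_const_sub]
  simp [localB, tderiv]

/-- The extensions of tangent a and b have zero covariant derivative at q because T β_v a = 0 and T
β_v b = 0, so both correction terms of ∇B vanish. -/
theorem covDerivSecondFundamentalForm_eq (hq : q ∈ (extChartAt (𝓡 n) p).source) (v : E) {a b : E}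
    (ha : localProj (chartRep (n := n) F p) (extChartAt (𝓡 n) p q) a = a)
    (hb : localProj (chartRep (n := n) F p) (extChartAt (𝓡 n) p q) b = b) :
    covDerivSecondFundamentalForm (n := n) F q v a b =
      (1 - localProj (chartRep (n := n) F p) (extChartAt (𝓡 n) p q))
        (localW (chartRep (n := n) F p) v a (extChartAt (𝓡 n) p q) b) := by
  have hU := isOpen_extChartAt_target (I := 𝓡 n) p
  have hG := contDiffOn_chartRep hF p
  have hinj := fderiv_chartRep_injective hF himm p
  have hy := (extChartAt (𝓡 n) p).map_source hq
  have hconn : ∀ c : E, localProj (chartRep (n := n) F p) (extChartAt (𝓡 n) p q) c = c →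
      tangentConnection (n := n) F q v (tangentExtension (n := n) F c) = 0 := by
    intro c hc
    rw [tangentConnection, flatDeriv_tangentExtension hF himm hq, projT_eq hF himm hq]
    exact localProj_localB hU hG hinj hy v hc
  have hzero : localB (chartRep (n := n) F p) 0 (extChartAt (𝓡 n) p q) = 0 := by
    simp [localB, tderiv]
  have hT := differentiableAt_localProj_chart hF himm hq
  have hB := differentiableAt_localB hU hG hinj hy a
  have heq : (fun z => (1 - localProj (chartRep (n := n) F p) z)
      (localB (chartRep (n := n) F p) (localProj (chartRep (n := n) F p) z a) z
        (localProj (chartRep (n := n) F p) z b))) =ᶠ[nhds (extChartAt (𝓡 n) p q)]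
      fun z => (1 - localProj (chartRep (n := n) F p) z)
        (localB (chartRep (n := n) F p) a z (localProj (chartRep (n := n) F p) z b)) := by
    filter_upwards [hU.mem_nhds hy] with z hz
    rw [localB_localProj (hinj z hz)]
  have hd := heq.differentiableAt_iff.mpr ((hT.const_sub (1 : E →L[ℝ] E)).clm_apply
    (hB.clm_apply (hT.clm_apply (differentiableAt_const b))))
  simp only [covDerivSecondFundamentalForm]
  rw [hconn a ha, hconn b hb, secondFundamentalForm_eq hF himm hq,
    secondFundamentalForm_eq hF himm hq, hzero, map_zero, zero_apply, map_zero, sub_zero, sub_zero,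
    normalConnection, flatDeriv_eq hF himm hq (fun r hr => by
      rw [secondFundamentalForm_eq hF himm hr, tangentExtension, tangentExtension,
        projT_eq hF himm hr]) hd, projN_eq hF himm hq,
    fderiv_second_fundamental hU hG hinj hy v a b hb]

/-- The pointwise relations on the immersed submanifold `F` with constant Jordan angles. -/
theorem exists_isConstantAngleJet (Q₀ : Submodule ℝ E)
    (hCJA : HasConstantJordanAngles (n := n) F Q₀) (p : M) {θ : ℝ}
    (hθ : θ ∈ argN (n := n) F Q₀ p) :
    ∃ (β : E → E →L[ℝ] E) (W : E → E → E →L[ℝ] E),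
      IsConstantAngleJet (tangentPlane (n := n) F p).starProjection Q₀.starProjection β W
        (argN (n := n) F Q₀ p ∪ {0, Real.pi / 2}) (fun σ => Real.cos σ ^ 2) θ ∧
      (∀ v w, secondFundamentalForm (n := n) F p v w =
        (1 - (tangentPlane (n := n) F p).starProjection) (β v w)) ∧
      (∀ ν v, shapeOperator (n := n) F p ν v =
        (tangentPlane (n := n) F p).starProjection (β v ν)) ∧
      ∀ v a b, (tangentPlane (n := n) F p).starProjection a = a →
        (tangentPlane (n := n) F p).starProjection b = b →
        covDerivSecondFundamentalForm (n := n) F p v a b =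
          (1 - (tangentPlane (n := n) F p).starProjection) (W v a b) := by
  have hp := mem_extChartAt_source (I := 𝓡 n) p
  have hT : (tangentPlane (n := n) F p).starProjection =
    localProj (chartRep (n := n) F p) (extChartAt (𝓡 n) p p) := projT_eq hF himm hp
  refine ⟨fun v => localB (chartRep (n := n) F p) v (extChartAt (𝓡 n) p p),
    fun v w => localW (chartRep (n := n) F p) v w (extChartAt (𝓡 n) p p), ?_, ?_, ?_, ?_⟩
  · rw [hT]
    refine isConstantAngleJet_local (isOpen_extChartAt_target p) (contDiffOn_chartRep hF p)
      (fderiv_chartRep_injective hF himm p) ((extChartAt (𝓡 n) p).map_source hp)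
      (starProjection_mul_self Q₀) (isSelfAdjoint_starProjection Q₀) ?_
      (Finset.mem_union_left _ hθ) ?_
    · refine cos_sq_injOn.mono fun σ hσ => ?_
      have hpi := Real.pi_pos
      simp only [Finset.coe_union, Finset.coe_insert, Finset.coe_singleton, Set.mem_union,
        Finset.mem_coe, Set.mem_insert_iff, Set.mem_singleton_iff] at hσ
      rcases hσ with hσ | rfl | rfl
      · exact ⟨(mem_jordanAngleFinset.mp hσ).1, (mem_jordanAngleFinset.mp hσ).2.1⟩
      · exact ⟨le_rfl, by positivity⟩
      · exact ⟨by positivity, le_rfl⟩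
    · intro z hz
      have hq := (extChartAt (𝓡 n) p).map_target hz
      have hTq : (tangentPlane (n := n) F ((extChartAt (𝓡 n) p).symm z)).starProjection =
          localProj (chartRep (n := n) F p) (extChartAt (𝓡 n) p ((extChartAt (𝓡 n) p).symm z)) :=
        projT_eq hF himm hq
      rw [(extChartAt (𝓡 n) p).right_inv hz] at hTq
      rw [← hTq]
      refine aeval_angleOp_eq_zero _ _ _ ?_ (by simp) (by simp)
      intro σ hσ
      refine Finset.mem_union_left _ ?_
      -- Constancy of the angles enters here: the nodes taken at p serve every point of the chart.
      rw [hCJA.1 p ((extChartAt (𝓡 n) p).symm z)]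
      exact hσ
  · intro v w
    rw [hT]
    exact secondFundamentalForm_eq hF himm hp v w
  · intro ν v
    rw [hT]
    exact shapeOperator_eq hF himm hp ν v
  · intro v a b ha hb
    rw [hT] at ha hb ⊢
    exact covDerivSecondFundamentalForm_eq hF himm hp v ha hb

end Charts

/-! ### Angle-space projections as spectral idempotents -/

section Translation

variable {E : Type*} [NormedAddCommGroup E] [InnerProductSpace ℝ E] [FiniteDimensional ℝ E]
  {K Q : Submodule ℝ E} {β : E → E →L[ℝ] E} {W : E → E → E →L[ℝ] E} {S : Finset ℝ} {θ : ℝ}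
  (h : IsConstantAngleJet K.starProjection Q.starProjection β W S (fun σ => Real.cos σ ^ 2) θ)

include h

/-- The idempotent commutes with T, is self-adjoint and fixes the eigenvectors, so on normal vectors
it is the orthogonal projection, even when the angle space is zero. -/
theorem starProjection_normal_eq {σ : ℝ} (hσ : σ ∈ S) {z : E} (hz : K.starProjection z = 0) :
    (angleSpace Kᗮ Q σ).starProjection z = spectralIdempotent S (fun σ => Real.cos σ ^ 2)
      (angleOp K.starProjection Q.starProjection) σ z := by
  apply Submodule.eq_starProjection_of_mem_of_inner_eq_zero
  · rw [mem_angleSpace_normal, h.T_idem, hz, map_zero]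
    exact ⟨rfl, h.angleOp_idem hσ z⟩
  · intro u hu
    have hu' := (mem_angleSpace_normal.mp hu).2
    rw [inner_sub_left, inner_swap (h.idem_sa σ), h.idem_apply hσ hu', sub_self]

theorem starProjection_tangent_eq {σ : ℝ} (hσ : σ ∈ S) {z : E} (hz : K.starProjection z = z) :
    (angleSpace K Qᗮ σ).starProjection z = spectralIdempotent S (fun σ => Real.cos σ ^ 2)
      (angleOp K.starProjection Q.starProjection) σ z := by
  apply Submodule.eq_starProjection_of_mem_of_inner_eq_zero
  · rw [mem_angleSpace_tangent, IsTangentEigen, h.T_idem, hz]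
    exact ⟨rfl, h.angleOp_idem hσ z⟩
  · intro u hu
    have hu' := (mem_angleSpace_tangent.mp hu).2
    rw [inner_sub_left, inner_swap (h.idem_sa σ), h.idem_apply hσ hu', sub_self]

end Translation

theorem kappa_eq (θ σ : ℝ) : kappa θ σ =
    (Real.sin θ * Real.cos θ) * (Real.cos θ ^ 2 - Real.cos σ ^ 2)⁻¹ := by
  rw [kappa, Real.sin_two_mul, Real.cos_two_mul, Real.cos_two_mul,
    show 2 * Real.cos θ ^ 2 - 1 - (2 * Real.cos σ ^ 2 - 1) =
      2 * (Real.cos θ ^ 2 - Real.cos σ ^ 2) by ring, mul_assoc 2 (Real.sin θ),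
    mul_div_mul_left _ _ two_ne_zero, div_eq_mul_inv]

/-! ### Passing from J to Φ, and the identities on the submanifold -/

section Submanifold

variable {n : ℕ} {E : Type*} [NormedAddCommGroup E] [InnerProductSpace ℝ E]
  [FiniteDimensional ℝ E] {M : Type*} [TopologicalSpace M]
  [ChartedSpace (EuclideanSpace ℝ (Fin n)) M] {F : M → E} {p : M} {Q₀ : Submodule ℝ E}

/-- `sin σ cos σ Φ_σ` is the commutator of `𝒫₀` and the tangent projection. -/
theorem smul_antiInvolution {σ : ℝ} (h0 : 0 ≤ σ) (h1 : σ ≤ Real.pi / 2) {z : E}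
    (hz : angleOp (tangentPlane (n := n) F p).starProjection Q₀.starProjection z =
      Real.cos σ ^ 2 • z) :
    (Real.sin σ * Real.cos σ) • antiInvolution (n := n) F Q₀ p σ z =
      crossOp (tangentPlane (n := n) F p).starProjection Q₀.starProjection z := by
  have hT := starProjection_mul_self (tangentPlane (n := n) F p)
  have hP := starProjection_mul_self Q₀
  by_cases hσ : 0 < σ ∧ σ < Real.pi / 2
  · have hc : Real.cos σ ≠ 0 := (Real.cos_pos_of_mem_Ioo ⟨by linarith, hσ.2⟩).ne'
    have hs : Real.sin σ ≠ 0 :=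
      (Real.sin_pos_of_pos_of_lt_pi hσ.1 (by linarith [Real.pi_pos])).ne'
    have hN : projN (n := n) F p = 1 - (tangentPlane (n := n) F p).starProjection :=
      starProjection_orthogonal_eq _
    have hT' : projT (n := n) F p = (tangentPlane (n := n) F p).starProjection := rfl
    have hsum : Q₀.starProjection (projN (n := n) F p z) +
        Q₀ᗮ.starProjection (projT (n := n) F p z) =
        Real.cos σ ^ 2 • z -
          crossOp (tangentPlane (n := n) F p).starProjection Q₀.starProjection z := by
      rw [← hz, angleOp_apply hT hP, hN, hT', starProjection_orthogonal_eq, crossOp]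
      simp only [sub_apply, one_apply_eq_self, mul_apply_eq_comp, map_sub]
      abel
    rw [antiInvolution, if_pos hσ, hsum, smul_smul, smul_sub, smul_sub, smul_sub, smul_smul,
      smul_smul, smul_smul]
    have e1 : Real.sin σ * Real.cos σ * (Real.sin σ)⁻¹ * Real.cos σ = Real.cos σ ^ 2 := by
      field_simp
    have e2 : Real.sin σ * Real.cos σ * (Real.sin σ)⁻¹ * (Real.cos σ)⁻¹ = 1 := by
      field_simp
    rw [e1, e2, one_mul, smul_smul, e2, one_smul]
    abel
  -- At σ = 0 or π/2 the convention Φ = 0 is consistent, as ‖Jz‖² = (sin σ cos σ)² ‖z‖² = 0.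
  · have hsc : Real.sin σ * Real.cos σ = 0 := by
      rcases h0.eq_or_lt with rfl | h0
      · simp
      · rw [le_antisymm h1 (not_lt.mp fun h2 => hσ ⟨h0, h2⟩)]
        simp
    have hJ := inner_crossOp_self hT hP (isSelfAdjoint_starProjection _)
      (isSelfAdjoint_starProjection _) hz
    rw [← Real.sin_sq, ← mul_pow, mul_comm (Real.cos σ), hsc] at hJ
    rw [hsc, zero_smul]
    simp at hJ
    exact hJ.symm

variable [IsManifold (𝓡 n) ∞ M]

/-- With r = sin θ cos θ one has J = rΦ_θ on the eigenspace, κ_{θσ} = r (cos² θ - cos² σ)⁻¹, and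
(A^{Φ_θ(u)}a)_σ = r⁻¹ e_σ β_a(Ju). This turns `pointwise_identities` into the claim; angles absent
from `argN` or `argT` contribute zero, so all sums can run over the common node set. -/
theorem constantJordanAngles_identities
    (hF : ContMDiff (𝓡 n) 𝓘(ℝ, E) ∞ F)
    (himm : ∀ p : M, Function.Injective (differential (n := n) F p))
    (hCJA : HasConstantJordanAngles (n := n) F Q₀) {θ : ℝ}
    (hθ : θ ∈ argT (n := n) F Q₀ p) (hθ_pos : 0 < θ) (hθ_lt : θ < Real.pi / 2) {v w : E}
    (hv : v ∈ tangentAngleSpace (n := n) F Q₀ p θ)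
    (hw : w ∈ tangentAngleSpace (n := n) F Q₀ p θ) :
    (∑ σ ∈ (argN (n := n) F Q₀ p).erase θ,
        kappa θ σ * tensorR (n := n) F Q₀ p σ v w v w =
      3 * ∑ σ ∈ (argT (n := n) F Q₀ p).erase θ,
        kappa θ σ * tensorU (n := n) F Q₀ p θ σ v w v w) ∧
    inner ℝ (covDerivSecondFundamentalForm (n := n) F p v w w)
        (antiInvolution (n := n) F Q₀ p θ v) =
      (1 / 3) * ∑ σ ∈ (argN (n := n) F Q₀ p).erase θ, kappa θ σ *
        (inner ℝ (secondFundamentalFormAngle (n := n) F Q₀ p σ v v)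
            (secondFundamentalFormAngle (n := n) F Q₀ p σ w w)
          + 2 * ‖secondFundamentalFormAngle (n := n) F Q₀ p σ v w‖ ^ 2)
      - 2 * ∑ σ ∈ (argT (n := n) F Q₀ p).erase θ, kappa σ θ *
        inner ℝ (secondFundamentalFormAngle (n := n) F Q₀ p σ v w)
          (antiInvolution (n := n) F Q₀ p σ (shapeAngle (n := n) F Q₀ p θ σ v w)) := by
  have hpi := Real.pi_pos
  have hNT : ∀ σ, 0 < σ → σ < Real.pi / 2 → σ ∈ argT (n := n) F Q₀ p →
      σ ∈ argN (n := n) F Q₀ p := fun σ h0 h1 hσ =>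
    mem_jordanAngleFinset.mpr ⟨h0.le, h1.le,
      angleSpace_normal_ne_bot h0 h1 (mem_jordanAngleFinset.mp hσ).2.2⟩
  obtain ⟨β, W, h, hB, hA, hDB⟩ := exists_isConstantAngleJet hF himm Q₀ hCJA p
    (hNT θ hθ_pos hθ_lt hθ)
  set S : Finset ℝ := argN (n := n) F Q₀ p ∪ {0, Real.pi / 2} with hS
  set T := (tangentPlane (n := n) F p).starProjection with hT
  set P := Q₀.starProjection with hP
  have hSbd : ∀ σ ∈ S, 0 ≤ σ ∧ σ ≤ Real.pi / 2 := by
    intro σ hσ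
    simp only [hS, Finset.mem_union, Finset.mem_insert, Finset.mem_singleton] at hσ
    rcases hσ with hσ | rfl | rfl
    · exact ⟨(mem_jordanAngleFinset.mp hσ).1, (mem_jordanAngleFinset.mp hσ).2.1⟩
    · exact ⟨le_rfl, by positivity⟩
    · exact ⟨by positivity, le_rfl⟩
  have hNS : (argN (n := n) F Q₀ p).erase θ ⊆ S.erase θ :=
    Finset.erase_subset_erase _ Finset.subset_union_left
  have hTS : (argT (n := n) F Q₀ p).erase θ ⊆ S.erase θ := by
    refine Finset.erase_subset_erase _ fun σ hσ => ?_
    have hσ' := mem_jordanAngleFinset.mp hσ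
    rcases hσ'.1.eq_or_lt with rfl | h0
    · simp [hS]
    rcases hσ'.2.1.eq_or_lt with rfl | h1
    · simp [hS]
    exact Finset.mem_union_left _ (hNT σ h0 h1 hσ)
  have hv' := mem_angleSpace_tangent.mp hv
  have hw' := mem_angleSpace_tangent.mp hw
  set r := Real.sin θ * Real.cos θ with hr
  have hr0 : r ≠ 0 := (mul_pos (Real.sin_pos_of_pos_of_lt_pi hθ_pos (by linarith))
    (Real.cos_pos_of_mem_Ioo ⟨by linarith, hθ_lt⟩)).ne'
  have hr2 : Real.cos θ ^ 2 * (1 - Real.cos θ ^ 2) = r ^ 2 := by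
    rw [← Real.sin_sq, hr]
    ring
  set e := fun σ => spectralIdempotent S (fun σ => Real.cos σ ^ 2) (angleOp T P) σ with he
  set J := crossOp T P with hJ
  have hΦ : ∀ u, u ∈ tangentAngleSpace (n := n) F Q₀ p θ →
      antiInvolution (n := n) F Q₀ p θ u = r⁻¹ • J u := fun u hu => by
    rw [← smul_antiInvolution hθ_pos.le hθ_lt.le (mem_angleSpace_tangent.mp hu).2, ← hr, smul_smul,
      inv_mul_cancel₀ hr0, one_smul]
  have hNB : ∀ a u : E, T u = u → (1 - T) (β a u) = β a u := fun a u hu => by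
    rw [sub_apply, one_apply_eq_self, h.T_beta_of_tangent a hu, sub_zero]
  have hBe : ∀ σ ∈ S.erase θ, ∀ a u : E, T u = u →
      secondFundamentalFormAngle (n := n) F Q₀ p σ a u = e σ (β a u) := fun σ hσ a u hu => by
    rw [secondFundamentalFormAngle, hB, hNB a u hu]
    exact starProjection_normal_eq h (Finset.mem_of_mem_erase hσ) (h.T_beta_of_tangent a hu)
  have hYe : ∀ σ ∈ S.erase θ, ∀ a u : E, u ∈ tangentAngleSpace (n := n) F Q₀ p θ →
      shapeAngle (n := n) F Q₀ p θ σ u a = r⁻¹ • e σ (β a (J u)) := fun σ hσ a u hu => by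
    have hJu := h.T_crossOp_of_tangent (mem_angleSpace_tangent.mp hu).1
    rw [shapeAngle, hA, hΦ u hu, map_smul, map_smul, map_smul, h.T_beta_of_normal a hJu]
    exact congrArg (r⁻¹ • ·) (starProjection_tangent_eq h (Finset.mem_of_mem_erase hσ)
      (h.T_beta_of_normal a hJu))
  have hB0 : ∀ σ ∈ S.erase θ, σ ∉ (argN (n := n) F Q₀ p).erase θ → ∀ a u : E,
      secondFundamentalFormAngle (n := n) F Q₀ p σ a u = 0 := by
    intro σ hσ hσ' a u
    have hbot : normalAngleSpace (n := n) F Q₀ p σ = ⊥ := by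
      by_contra hne
      have hbd := hSbd σ (Finset.mem_of_mem_erase hσ)
      exact hσ' (Finset.mem_erase.mpr ⟨(Finset.mem_erase.mp hσ).1,
        mem_jordanAngleFinset.mpr ⟨hbd.1, hbd.2, hne⟩⟩)
    have hmem : secondFundamentalFormAngle (n := n) F Q₀ p σ a u ∈
        normalAngleSpace (n := n) F Q₀ p σ := Submodule.starProjection_apply_mem _ _
    rwa [hbot, Submodule.mem_bot] at hmem
  have hY0 : ∀ σ ∈ S.erase θ, σ ∉ (argT (n := n) F Q₀ p).erase θ → ∀ a u : E,
      shapeAngle (n := n) F Q₀ p θ σ u a = 0 := by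
    intro σ hσ hσ' a u
    have hbot : tangentAngleSpace (n := n) F Q₀ p σ = ⊥ := by
      by_contra hne
      have hbd := hSbd σ (Finset.mem_of_mem_erase hσ)
      exact hσ' (Finset.mem_erase.mpr ⟨(Finset.mem_erase.mp hσ).1,
        mem_jordanAngleFinset.mpr ⟨hbd.1, hbd.2, hne⟩⟩)
    have hmem : shapeAngle (n := n) F Q₀ p θ σ u a ∈
        tangentAngleSpace (n := n) F Q₀ p σ := Submodule.starProjection_apply_mem _ _
    rwa [hbot, Submodule.mem_bot] at hmem
  have hΦ0 : ∀ σ, antiInvolution (n := n) F Q₀ p σ 0 = 0 := fun σ => by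
    simp [antiInvolution]
  have hΦe : ∀ σ ∈ S.erase θ, ∀ z,
      (Real.sin σ * Real.cos σ) • antiInvolution (n := n) F Q₀ p σ (r⁻¹ • e σ z) =
        r⁻¹ • J (e σ z) := fun σ hσ z => by
    have hbd := hSbd σ (Finset.mem_of_mem_erase hσ)
    have hz : angleOp T P (r⁻¹ • e σ z) = Real.cos σ ^ 2 • (r⁻¹ • e σ z) := by
      rw [map_smul, he, h.angleOp_idem (Finset.mem_of_mem_erase hσ), smul_comm]
    rw [smul_antiInvolution hbd.1 hbd.2 hz, map_smul]
  obtain ⟨i1, i2⟩ := h.pointwise_identities (by rw [hr2]; exact pow_ne_zero 2 hr0) hv' hw'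
  rw [Finset.sum_subset hNS fun σ hσ hσ' => by simp [tensorR, hB0 σ hσ hσ'],
    Finset.sum_subset hTS fun σ hσ hσ' => by simp [tensorU, hY0 σ hσ hσ'],
    Finset.sum_subset hNS fun σ hσ hσ' => by simp [hB0 σ hσ hσ'],
    Finset.sum_subset hTS fun σ hσ hσ' => by simp [hY0 σ hσ hσ', hΦ0]]
  rw [hr2] at i1 i2
  constructor
  · apply mul_left_cancel₀ hr0
    trans ∑ σ ∈ S.erase θ, (Real.cos θ ^ 2 - Real.cos σ ^ 2)⁻¹ * r ^ 2 *
        (inner ℝ (e σ (β v v)) (e σ (β w w)) - inner ℝ (e σ (β v w)) (e σ (β w v)))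
    · rw [Finset.mul_sum]
      refine Finset.sum_congr rfl fun σ hσ => ?_
      rw [tensorR, hBe σ hσ v v hv'.1, hBe σ hσ w w hw'.1, hBe σ hσ v w hw'.1, hBe σ hσ w v hv'.1,
        kappa_eq]
      ring
    · refine i1.trans ?_
      rw [Finset.mul_sum, Finset.mul_sum, Finset.mul_sum]
      refine Finset.sum_congr rfl fun σ hσ => ?_
      rw [tensorU, hYe σ hσ v v hv, hYe σ hσ w w hw, hYe σ hσ v w hw, hYe σ hσ w v hv, kappa_eq]
      simp only [inner_smul_left, inner_smul_right, conj_trivial]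
      rw [← hr]
      field_simp
      rfl
  · have hWJ : inner ℝ ((1 - T) (W v w w)) (J v) = inner ℝ (W v w w) (J v) := by
      rw [sub_apply, one_apply_eq_self, inner_sub_left, inner_swap h.T_sa,
        h.T_crossOp_of_tangent hv'.1, inner_zero_right, sub_zero]
    rw [hDB v w w hw'.1 hw'.1, hΦ v hv, inner_smul_right, hWJ, i2, mul_add, sub_eq_add_neg]
    congr 1
    · rw [Finset.mul_sum, Finset.mul_sum, Finset.mul_sum]
      refine Finset.sum_congr rfl fun σ hσ => ?_
      rw [hBe σ hσ v v hv'.1, hBe σ hσ w w hw'.1, hBe σ hσ v w hw'.1, kappa_eq, ← hr]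
      field_simp
      rfl
    · rw [Finset.mul_sum, Finset.mul_sum, Finset.mul_sum, ← Finset.sum_neg_distrib]
      refine Finset.sum_congr rfl fun σ hσ => ?_
      -- κ_{σθ} has the reversed difference of cosines, which supplies the minus sign; its factor
      -- sin σ cos σ turns Φ_σ into J.
      have hsw : (Real.cos σ ^ 2 - Real.cos θ ^ 2)⁻¹ = -(Real.cos θ ^ 2 - Real.cos σ ^ 2)⁻¹ := by
        rw [← inv_neg, neg_sub]
      rw [hBe σ hσ v w hw'.1, hYe σ hσ w v hv, kappa_eq, hsw]
      have hi := congrArg (inner ℝ (e σ (β v w))) (hΦe σ hσ (β w (J v)))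
      rw [inner_smul_right, inner_smul_right] at hi
      change r⁻¹ * (2 * (_ * inner ℝ (e σ (β v w)) (J (e σ (β w (J v)))))) = _
      linear_combination (-2 * (Real.cos θ ^ 2 - Real.cos σ ^ 2)⁻¹) * hi

end Submanifold

end CJA

end

theorem mainTheorem7 (n m : ℕ) {M : Type*} [TopologicalSpace M]
    [ChartedSpace (EuclideanSpace ℝ (Fin n)) M] [IsManifold (𝓡 n) ∞ M]
    (F : M → EuclideanSpace ℝ (Fin (n + m)))
    (hF : ContMDiff (𝓡 n) 𝓘(ℝ, EuclideanSpace ℝ (Fin (n + m))) ∞ F)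
    (hF_imm : ∀ p : M, Function.Injective (CJA.differential (n := n) F p))
    (Q₀ : Submodule ℝ (EuclideanSpace ℝ (Fin (n + m)))) (hQ₀ : Module.finrank ℝ Q₀ = m)
    (hCJA : CJA.HasConstantJordanAngles (n := n) F Q₀)
    (p : M) (θ : ℝ) (hθ : θ ∈ CJA.argT (n := n) F Q₀ p) (hθ_pos : 0 < θ) (hθ_lt : θ < Real.pi / 2)
    (v w : EuclideanSpace ℝ (Fin (n + m)))
    (hv : v ∈ CJA.tangentAngleSpace (n := n) F Q₀ p θ)
    (hw : w ∈ CJA.tangentAngleSpace (n := n) F Q₀ p θ) :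
    (∑ σ ∈ (CJA.argN (n := n) F Q₀ p).erase θ,
        CJA.kappa θ σ * CJA.tensorR (n := n) F Q₀ p σ v w v w =
      3 * ∑ σ ∈ (CJA.argT (n := n) F Q₀ p).erase θ,
        CJA.kappa θ σ * CJA.tensorU (n := n) F Q₀ p θ σ v w v w) ∧
    inner ℝ (CJA.covDerivSecondFundamentalForm (n := n) F p v w w)
        (CJA.antiInvolution (n := n) F Q₀ p θ v) =
      (1 / 3) * ∑ σ ∈ (CJA.argN (n := n) F Q₀ p).erase θ, CJA.kappa θ σ *
        (inner ℝ (CJA.secondFundamentalFormAngle (n := n) F Q₀ p σ v v)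
            (CJA.secondFundamentalFormAngle (n := n) F Q₀ p σ w w)
          + 2 * ‖CJA.secondFundamentalFormAngle (n := n) F Q₀ p σ v w‖ ^ 2)
      - 2 * ∑ σ ∈ (CJA.argT (n := n) F Q₀ p).erase θ, CJA.kappa σ θ *
        inner ℝ (CJA.secondFundamentalFormAngle (n := n) F Q₀ p σ v w)
          (CJA.antiInvolution (n := n) F Q₀ p σ
            (CJA.shapeAngle (n := n) F Q₀ p θ σ v w)) :=
  CJA.constantJordanAngles_identities hF hF_imm hCJA hθ hθ_pos hθ_lt hv hw
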